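/- **Setting.** Let $\mathbb Y$ be a set, $\theta\ge 0$, and for each $y\in\mathbb Y$ let $d_y:(\mathbb Y\setminus\{y\})\times(\mathbb Y\setminus\{y\})\to\mathbb R_{\ge 0}$ be a function such that, whenever the terms are defined: $d_y(x,z)=d_y(z,x)$; $d_y(x,w)\le d_y(x,z)+d_y(z,w)$; $\min\{d_y(x,z),d_z(x,y)\}\le\theta$; and $\{y : d_y(x,z)>\theta\}$ is finite for all $x,z$. For $x\ne z$ let $\mathcal H(x,z)$ be the set of pairs $(x',z')$ with $x'\neq z'$ such that (all terms being defined) one of the following holds: $d_x(x',z')>2\theta$ and $d_z(x',z')>2\theta$; or $x'=x$ and $d_z(x,z')>2\theta$; or $z'=z$ and $d_x(x',z)>2\theta$; or $(x',z')=(x,z)$. For $y\ne x,z$ put $d'_y(x,z)=0$ if $y$ occurs in a pair of $\mathcal H(x,z)$, and $d'_y(x,z)=\inf_{(x',z')\in\mathcal H(x,z)}d_y(x',z')$ otherwise (the modified distance functions of Bestvina–Bromberg–Fujiwara). For $K\ge 0$ let $\mathcal P=\mathcal P_K(\mathbb Y)$ be the graph with vertex set $\mathbb Y$ in which distinct $x,z$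 are adjacent when $d'_y(x,z)\le K$ for all $y\ne x,z$, and let $d$ be its path metric. We call $\mathcal P$ a *projection complex* if it is connected and there are constants $C_{\rm e},C_{\rm p},C_{\rm g}$ such that, for all vertices $x,y,z$ with $x\ne y\ne z$: $d_y(x,z)\le C_{\rm e}$ if $d(x,z)=1$; $d_y(x,z)\le C_{\rm p}$ if some edge path from $x$ to $z$ has all its vertices at distance greater than $2$ from $y$; and $d_y(x,z)\le C_{\rm g}$ if some geodesic from $x$ to $z$ does not pass through $y$. A group $G$ *acts on* $\mathcal P$ if it acts on $\mathbb Y$ with $d_{gy}(gx,gz)=d_y(x,z)$ whenever $x\neq y\neq z$; it then acts on the graph $\mathcal P$ by automorphisms. For $L>0$, an *equivariant $L$-spinning family* is a family of subgroups $R_v\le\mathrm{Stab}_G(v)$, $v\in\mathbb Y$, such that $gR_vg^{-1}=R_{gv}$ for all $g\in G$ and $v\in\mathbb Y$, and $d_v(w,hw)\ge L$ for all $v\ne w$ and all nontrivial $h\in R_v$. Let $H=\langle R_v\rangle$ be the subgroup generated by all $R_v$, and let $p:\mathcal P\to\mathcal P/H$ be the quotient map of graphs. Paths are edge paths between vertices;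 geodesics are shortest such paths. A *geodesic quadrilateral* in a graph consists of geodesics $\alpha_k$ from $x_k$ to $x_{k+1 \bmod 4}$, $k=0,1,2,3$ (constant sides are allowed). **Proposition 4.3.** Let $\mathcal P$ be a projection complex and let $B\ge 0$. There is a constant $L_{\rm lift}(B)$, depending only on $\mathcal P$ and $B$, with the following property. Let $G$ be a group acting on $\mathcal P$, let $L\ge L_{\rm lift}(B)$ with $L>0$, let $\{R_v\}$ be an equivariant $L$-spinning family of subgroups of $G$, and let $H=\langle R_v\rangle$. Then for each geodesic quadrilateral $\bar Q=\bigcup_{k=0}^3\bar\alpha_k$ in $\mathcal P/H$ there is a geodesic quadrilateral $Q=\bigcup_{k=0}^3\alpha_k$ in $\mathcal P$ with $p(\alpha_k)=\bar\alpha_k$ for $k=0,1,2,3$. Additionally, $Q$ has the following property. If $\tilde\alpha_0$, from $\tilde x_0$ to $\tilde x_1$, and $\tilde\alpha_2$, from $\tilde x_2$ to $\tilde x_3$, are lifts to $\mathcal P$ of $\bar\alpha_0$ and $\bar\alpha_2$ respectively such that $d_v(\tilde x_0,\tilde x_1)\le B$ and $d_v(\tilde x_2,\tilde x_3)\le B$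 for every vertex $v$ for which the respective term is defined, then $\alpha_0$ and $\alpha_2$ are $H$-translates of $\tilde\alpha_0$ and $\tilde\alpha_2$ respectively. -/

import Mathlib

universe u v

/-! ## Graphs (loops and multiple edges allowed) and edge paths

An undirected graph is given by its vertices, its oriented edges, and the reversal of oriented
edges. Reversal may fix an oriented edge: quotients of graphs by groups that invert
edges are allowed. -/

/-- A graph, described by vertices and oriented edges. -/
structure EdgeGraph where
  V : Type u
  E : Type u
  src : E → V
  tgt : E → V
  rev : E → E
  src_rev : ∀ e, src (rev e) = tgt e
  tgt_rev : ∀ e, tgt (rev e) = src e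
  rev_rev : ∀ e, rev (rev e) = e

namespace EdgeGraph

/-- `X.Follows a l b`: the oriented edges in the list `l` form an edge path from `a` to `b`. -/
def Follows (X : EdgeGraph.{u}) : X.V → List X.E → X.V → Prop
  | a, [], b => a = b
  | a, e :: l, b => X.src e = a ∧ X.Follows (X.tgt e) l b

/-- An edge path of `X`, from the vertex `start` to the vertex `finish`. -/
@[ext]
structure EdgePath (X : EdgeGraph.{u}) where
  start : X.V
  finish : X.V
  edges : List X.E
  follows : X.Follows start edges finish

/-- The number of edges of a path. -/
def EdgePath.length {X : EdgeGraph.{u}} (α : X.EdgePath) : ℕ := α.edges.length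

/-- A geodesic for the path metric in which each edge has length one: no path with the
same endpoints is shorter. -/
def EdgePath.IsGeodesic {X : EdgeGraph.{u}} (α : X.EdgePath) : Prop :=
  ∀ β : X.EdgePath, β.start = α.start → β.finish = α.finish → α.length ≤ β.length

/-- The four paths `α 0, α 1, α 2, α 3` are the sides of a geodesic quadrilateral: each is a
geodesic, and `α k` ends where `α (k + 1)` starts, with indices modulo 4. -/
def IsGeodesicQuadrilateral {X : EdgeGraph.{u}} (α : Fin 4 → X.EdgePath) : Prop :=
  (∀ k, (α k).IsGeodesic) ∧ ∀ k, (α k).finish = (α (k + 1)).start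

/-- A morphism of graphs. -/
structure Hom (X Y : EdgeGraph.{u}) where
  onV : X.V → Y.V
  onE : X.E → Y.E
  src_onE : ∀ e, Y.src (onE e) = onV (X.src e)
  tgt_onE : ∀ e, Y.tgt (onE e) = onV (X.tgt e)
  rev_onE : ∀ e, Y.rev (onE e) = onE (X.rev e)

theorem Follows.map {X Y : EdgeGraph.{u}} (f : Hom X Y) :
    ∀ {a : X.V} {l : List X.E} {b : X.V}, X.Follows a l b →
      Y.Follows (f.onV a) (l.map f.onE) (f.onV b)
  | _, [], _, h => congrArg f.onV h
  | _, e :: l, b, h => by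
    refine ⟨by rw [f.src_onE, h.1], ?_⟩
    have h2 := Follows.map f h.2
    rw [← f.tgt_onE] at h2
    exact h2

/-- The image `f ∘ α` of a path under a morphism of graphs. -/
def EdgePath.map {X Y : EdgeGraph.{u}} (f : Hom X Y) (α : X.EdgePath) : Y.EdgePath where
  start := f.onV α.start
  finish := f.onV α.finish
  edges := α.edges.map f.onE
  follows := α.follows.map f

end EdgeGraph

/-! ## Projection complexes -/

/-- A set `Y` with functions `d y : Y ∖ {y} × Y ∖ {y} → ℝ≥0` satisfying the projection complex
axioms with constant `θ`. Values `d y x z` with `x = y` or `z = y` carry no meaning. -/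
structure ProjectionSystem (Y : Type u) where
  θ : ℝ
  d : Y → Y → Y → ℝ
  θ_nonneg : 0 ≤ θ
  nonneg : ∀ y x z, x ≠ y → z ≠ y → 0 ≤ d y x z
  symm : ∀ y x z, x ≠ y → z ≠ y → d y x z = d y z x
  triangle : ∀ y x z w, x ≠ y → z ≠ y → w ≠ y → d y x w ≤ d y x z + d y z w
  triples : ∀ x y z, x ≠ y → x ≠ z → y ≠ z → min (d y x z) (d z x y) ≤ θ
  finite : ∀ x z, {y | y ≠ x ∧ y ≠ z ∧ θ < d y x z}.Finite

namespace ProjectionSystem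

variable {Y : Type u} (S : ProjectionSystem Y)

/-- The set of pairs `(x', z')` of Bestvina, Bromberg and Fujiwara over which the infimum
defining the modified distance between `x` and `z` is taken. -/
def modPairs (x z : Y) : Set (Y × Y) :=
  {p | p.1 ≠ p.2 ∧
    ((p.1 ≠ x ∧ p.2 ≠ x ∧ p.1 ≠ z ∧ p.2 ≠ z ∧
        2 * S.θ < S.d x p.1 p.2 ∧ 2 * S.θ < S.d z p.1 p.2) ∨
      (p.1 = x ∧ x ≠ z ∧ p.2 ≠ z ∧ 2 * S.θ < S.d z x p.2) ∨
      (p.2 = z ∧ z ≠ x ∧ p.1 ≠ x ∧ 2 * S.θ < S.d x p.1 z) ∨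
      (p.1 = x ∧ p.2 = z))}

open Classical in
/-- The modified distance function `d'` of Bestvina, Bromberg and Fujiwara (meaningful for
`x ≠ z` and `y ≠ x, z`): zero if `y` occurs in a pair of `modPairs x z`, and otherwise the infimum
of `d y x' z'` over the pairs `(x', z')` of `modPairs x z`. -/
noncomputable def modDist (y x z : Y) : ℝ :=
  if ∃ p ∈ S.modPairs x z, p.1 = y ∨ p.2 = y then 0
  else sInf ((fun p : Y × Y => S.d y p.1 p.2) '' S.modPairs x z)

theorem modPairs_swap {x z : Y} {p : Y × Y} (h : p ∈ S.modPairs x z) :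
    p.swap ∈ S.modPairs z x := by
  obtain ⟨hne, h⟩ := h
  refine ⟨hne.symm, ?_⟩
  simp only [Prod.fst_swap, Prod.snd_swap]
  rcases h with ⟨h1, h2, h3, h4, h5, h6⟩ | ⟨h1, h2, h3, h4⟩ | ⟨h1, h2, h3, h4⟩ | ⟨h1, h2⟩
  · exact Or.inl ⟨h4, h3, h2, h1, by rwa [S.symm z _ _ h4 h3], by rwa [S.symm x _ _ h2 h1]⟩
  · exact Or.inr (Or.inr (Or.inl ⟨h1, h2, h3, by rwa [S.symm z _ _ h3 h2]⟩))
  · exact Or.inr (Or.inl ⟨h1, h2, h3, by rwa [S.symm x _ _ h2 h3]⟩)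
  · exact Or.inr (Or.inr (Or.inr ⟨h2, h1⟩))

theorem modDist_symm (y x z : Y) : S.modDist y x z = S.modDist y z x := by
  have key : ∀ a b : Y, (∃ p ∈ S.modPairs a b, p.1 = y ∨ p.2 = y) →
      ∃ p ∈ S.modPairs b a, p.1 = y ∨ p.2 = y := by
    rintro a b ⟨p, hp, h⟩
    exact ⟨p.swap, S.modPairs_swap hp, h.symm⟩
  unfold modDist
  by_cases h : ∃ p ∈ S.modPairs x z, p.1 = y ∨ p.2 = y
  · rw [if_pos h, if_pos (key _ _ h)]
  · have h' : ¬ ∃ p ∈ S.modPairs z x, p.1 = y ∨ p.2 = y := fun h' => h (key _ _ h')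
    rw [if_neg h, if_neg h']
    congr 1
    ext r
    constructor
    · rintro ⟨p, hp, rfl⟩
      exact ⟨p.swap, S.modPairs_swap hp,
        S.symm y _ _ (fun e => h ⟨p, hp, Or.inr e⟩) (fun e => h ⟨p, hp, Or.inl e⟩)⟩
    · rintro ⟨p, hp, rfl⟩
      exact ⟨p.swap, S.modPairs_swap hp,
        S.symm y _ _ (fun e => h' ⟨p, hp, Or.inr e⟩) (fun e => h' ⟨p, hp, Or.inl e⟩)⟩

/-- The graph with vertex set `Y` in which distinct `x` and `z` are adjacent when
`d'_y(x, z) ≤ K` for all `y ≠ x, z`. -/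
def graph (K : ℝ) : SimpleGraph Y where
  Adj x z := x ≠ z ∧ ∀ y, y ≠ x → y ≠ z → S.modDist y x z ≤ K
  symm := ⟨fun x z h => ⟨h.1.symm, fun y hz hx => by
    rw [S.modDist_symm]; exact h.2 y hx hz⟩⟩
  loopless := ⟨fun _ h => h.1 rfl⟩

/-- `S.graph K` is a projection complex: `K ≥ 0`, the graph is connected (so that the path metric
is finite), and the bounded edge, path and geodesic image properties hold for some constants. -/
def IsProjectionComplex (K : ℝ) : Prop :=
  0 ≤ K ∧ (S.graph K).Preconnected ∧
    ∃ Ce Cp Cg : ℝ,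
      (∀ x y z, x ≠ y → z ≠ y → (S.graph K).dist x z = 1 → S.d y x z ≤ Ce) ∧
      (∀ x y z, x ≠ y → z ≠ y → ∀ w : (S.graph K).Walk x z,
        (∀ a ∈ w.support, 2 < (S.graph K).dist y a) → S.d y x z ≤ Cp) ∧
      (∀ x y z, x ≠ y → z ≠ y → ∀ w : (S.graph K).Walk x z,
        w.length = (S.graph K).dist x z → y ∉ w.support → S.d y x z ≤ Cg)

/-- `S.graph K` as a graph with oriented edges. -/
def complex (K : ℝ) : EdgeGraph.{u} where
  V := Y
  E := (S.graph K).Dart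
  src e := e.fst
  tgt e := e.snd
  rev e := e.symm
  src_rev _ := rfl
  tgt_rev _ := rfl
  rev_rev e := e.symm_symm

/-! ## Group actions, spinning families and quotients -/

section Action

variable (G : Type v) [Group G] [MulAction G Y]

/-- The action of `G` on the set `Y` is an action on the projection complex: the functions `d y`
are `G`-invariant. -/
def IsInvariant : Prop :=
  ∀ (g : G) (y x z : Y), x ≠ y → z ≠ y → S.d (g • y) (g • x) (g • z) = S.d y x z

variable {S G}

theorem IsInvariant.modPairs_smul (hG : S.IsInvariant G) (g : G) {x z : Y} {p : Y × Y}
    (h : p ∈ S.modPairs x z) : (g • p.1, g • p.2) ∈ S.modPairs (g • x) (g • z) := by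
  have ne : ∀ {a b : Y}, a ≠ b → g • a ≠ g • b := fun hab => (MulAction.injective g).ne hab
  obtain ⟨hne, h⟩ := h
  refine ⟨ne hne, ?_⟩
  rcases h with ⟨h1, h2, h3, h4, h5, h6⟩ | ⟨h1, h2, h3, h4⟩ | ⟨h1, h2, h3, h4⟩ | ⟨h1, h2⟩
  · exact Or.inl ⟨ne h1, ne h2, ne h3, ne h4, by rwa [hG g x _ _ h1 h2],
      by rwa [hG g z _ _ h3 h4]⟩
  · exact Or.inr (Or.inl ⟨congrArg _ h1, ne h2, ne h3, by rwa [hG g z _ _ h2 h3]⟩)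
  · exact Or.inr (Or.inr (Or.inl ⟨congrArg _ h1, ne h2, ne h3, by rwa [hG g x _ _ h3 h2]⟩))
  · exact Or.inr (Or.inr (Or.inr ⟨congrArg _ h1, congrArg _ h2⟩))

theorem IsInvariant.modPairs_smul_inv (hG : S.IsInvariant G) (g : G) {x z : Y} {p : Y × Y}
    (h : p ∈ S.modPairs (g • x) (g • z)) : (g⁻¹ • p.1, g⁻¹ • p.2) ∈ S.modPairs x z := by
  have := hG.modPairs_smul g⁻¹ h
  rwa [inv_smul_smul, inv_smul_smul] at this

theorem IsInvariant.modDist_smul (hG : S.IsInvariant G) (g : G) (y x z : Y) :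
    S.modDist (g • y) (g • x) (g • z) = S.modDist y x z := by
  unfold modDist
  by_cases h : ∃ p ∈ S.modPairs x z, p.1 = y ∨ p.2 = y
  · have h' : ∃ p ∈ S.modPairs (g • x) (g • z), p.1 = g • y ∨ p.2 = g • y := by
      obtain ⟨p, hp, e⟩ := h
      exact ⟨_, hG.modPairs_smul g hp, e.imp (congrArg _) (congrArg _)⟩
    rw [if_pos h, if_pos h']
  · have h' : ¬ ∃ p ∈ S.modPairs (g • x) (g • z), p.1 = g • y ∨ p.2 = g • y := by
      rintro ⟨p, hp, e⟩
      exact h ⟨_, hG.modPairs_smul_inv g hp,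
        e.imp (fun e => by simp [e]) (fun e => by simp [e])⟩
    rw [if_neg h, if_neg h']
    congr 1
    ext r
    constructor
    · rintro ⟨p, hp, rfl⟩
      have hp' := hG.modPairs_smul_inv g hp
      refine ⟨_, hp', ?_⟩
      have := hG g y (g⁻¹ • p.1) (g⁻¹ • p.2) (fun e => h ⟨_, hp', Or.inl e⟩)
        (fun e => h ⟨_, hp', Or.inr e⟩)
      simpa using this.symm
    · rintro ⟨p, hp, rfl⟩
      exact ⟨_, hG.modPairs_smul g hp,
        hG g y _ _ (fun e => h ⟨p, hp, Or.inl e⟩) (fun e => h ⟨p, hp, Or.inr e⟩)⟩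

theorem IsInvariant.adj_smul (hG : S.IsInvariant G) {K : ℝ} (g : G) {x z : Y}
    (h : (S.graph K).Adj x z) : (S.graph K).Adj (g • x) (g • z) := by
  refine ⟨(MulAction.injective g).ne h.1, fun y hx hz => ?_⟩
  have := h.2 (g⁻¹ • y) (fun e => hx (by rw [← e, smul_inv_smul]))
    (fun e => hz (by rw [← e, smul_inv_smul]))
  rwa [← hG.modDist_smul g, smul_inv_smul] at this

/-- The simplicial map of the complex given by the action of `g`. The path
`α.map (hG.translate K g)` is the translate `gα`. -/
def IsInvariant.translate (hG : S.IsInvariant G) (K : ℝ) (g : G) :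
    EdgeGraph.Hom (S.complex K) (S.complex K) where
  onV := fun x : Y => g • x
  onE e := ⟨(g • e.fst, g • e.snd), hG.adj_smul g e.adj⟩
  src_onE _ := rfl
  tgt_onE _ := rfl
  rev_onE _ := rfl

variable (S)

/-- `R` is an equivariant `L`-spinning family of subgroups of `G`. -/
structure IsSpinningFamily (L : ℝ) (R : Y → Subgroup G) : Prop where
  pos : 0 < L
  le_stabilizer : ∀ v, R v ≤ MulAction.stabilizer G v
  equivariant : ∀ (g : G) (v : Y), (R v).map (MulAut.conj g).toMonoidHom = R (g • v)
  spinning : ∀ v w : Y, v ≠ w → ∀ h ∈ R v, h ≠ 1 → L ≤ S.d v w (h • w)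

/-- Two oriented edges are identified when an element of `H` carries one to the other. -/
def edgeSetoid (K : ℝ) (H : Subgroup G) : Setoid (S.graph K).Dart where
  r e f := ∃ h ∈ H, h • e.fst = f.fst ∧ h • e.snd = f.snd
  iseqv :=
    { refl := fun _ => ⟨1, H.one_mem, one_smul _ _, one_smul _ _⟩
      symm := by
        rintro e f ⟨h, hh, h1, h2⟩
        exact ⟨h⁻¹, H.inv_mem hh, by rw [← h1, inv_smul_smul], by rw [← h2, inv_smul_smul]⟩
      trans := by
        rintro e f k ⟨h, hh, h1, h2⟩ ⟨h', hh', h1', h2'⟩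
        exact ⟨h' * h, H.mul_mem hh' hh, by rw [mul_smul, h1, h1'], by rw [mul_smul, h2, h2']⟩ }

theorem orbit_mk_eq (H : Subgroup G) {h : G} (hh : h ∈ H) {x z : Y} (e : h • x = z) :
    (Quotient.mk (MulAction.orbitRel H Y) x) = Quotient.mk (MulAction.orbitRel H Y) z :=
  Quotient.sound ((MulAction.orbitRel H Y).symm ⟨⟨h, hh⟩, e⟩)

/-- The quotient graph of the complex by a subgroup `H`: its vertices are the `H`-orbits of
vertices and its oriented edges are the `H`-orbits of oriented edges. -/
def quotientComplex (K : ℝ) (H : Subgroup G) : EdgeGraph.{u} where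
  V := MulAction.orbitRel.Quotient H Y
  E := Quotient (S.edgeSetoid K H)
  src := Quotient.lift (fun e => Quotient.mk (MulAction.orbitRel H Y) e.fst)
    (fun _ _ ⟨_, hh, h1, _⟩ => orbit_mk_eq H hh h1)
  tgt := Quotient.lift (fun e => Quotient.mk (MulAction.orbitRel H Y) e.snd)
    (fun _ _ ⟨_, hh, _, h2⟩ => orbit_mk_eq H hh h2)
  rev := Quotient.map (fun e => e.symm) (fun _ _ ⟨h, hh, h1, h2⟩ => ⟨h, hh, h2, h1⟩)
  src_rev := by rintro ⟨e⟩; rfl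
  tgt_rev := by rintro ⟨e⟩; rfl
  rev_rev := by
    rintro ⟨e⟩
    exact congrArg (Quotient.mk (S.edgeSetoid K H)) e.symm_symm

/-- The quotient map from the complex to its quotient by `H`. -/
def quotientMap (K : ℝ) (H : Subgroup G) :
    EdgeGraph.Hom (S.complex K) (S.quotientComplex K H) where
  onV x := Quotient.mk (MulAction.orbitRel H Y) x
  onE e := Quotient.mk (S.edgeSetoid K H) e
  src_onE _ := rfl
  tgt_onE _ := rfl
  rev_onE _ := rfl

end Action

/-- `d_v(x, z) ≤ B` for every vertex `v` for which it is defined, where `x` and `z` are the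
endpoints of the path `α`. -/
def ProjectionsBoundedBy (S : ProjectionSystem Y) {K : ℝ} (α : (S.complex K).EdgePath)
    (B : ℝ) : Prop :=
  ∀ v : Y, v ≠ α.start → v ≠ α.finish → S.d v α.start α.finish ≤ B

end ProjectionSystem

/-- The subgroup `⟨R_v⟩` generated by a family of subgroups. -/
def familySpan {Y : Type u} {G : Type v} [Group G] (R : Y → Subgroup G) : Subgroup G :=
  ⨆ v, R v

/-! A path whose image in the quotient is a geodesic is itself a geodesic, so the task is to choose
lifts of the four sides that close up. Lifting the sides one after another gives a chain from a
vertex `x` to some `h • x` with `h` in `H`. If `h • x ≠ x`, there is a vertex `v` whose projection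
distance between `x` and `h • x` is at least `L - 15 * C`, which exceeds `4 * (B + C)`. By the
triangle inequality some side has an endpoint at `v` or has projection to `v` larger than `B + C`;
in the latter case the side passes through `v`. Rotating everything after `v` by an element of `R v`
(`exists_bend`) gives another chain of lifts with a simpler last endpoint, and `exists_closed_chain`
repeats this until the chain closes.

If sides 0 and 2 have lifts with projections at most `B`, only their translates are admitted. Such a
lift never needs to be bent in its interior, so the same argument applies (`isFlexible_translates`).
Lifts with projections at most `B` are unique up to translation (`exists_translate_eq`), so the
choice made does not matter.

The repetition terminates by `shortening_induction`, which rests on a windmill: starting from `{x}`,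
take the neighbourhood of the current set `W` and let the groups attached to its vertices act.
Ping-pong (`Reduced.pingpong`) shows that a reduced product of rotations about vertices of the
neighbourhood outside `W` moves `W` so as to have large projection to its first rotation vertex.
Undoing the first rotation shortens the word, and the empty word leads back to the previous stage.
Ping-pong needs a uniform bound on the projections of `W` to vertices outside it;
`projBounded_windmill` supplies one that does not grow with the stage. -/

namespace ProjectionSystem

variable {Y : Type u} {S : ProjectionSystem Y} {K C : ℝ}

/-- The bounded edge, path and geodesic image properties of a projection complex, with one
constant `C`, which also bounds `θ`. -/
structure HasBounds (S : ProjectionSystem Y) (K C : ℝ) : Prop where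
  θ_le : S.θ ≤ C
  preconnected : (S.graph K).Preconnected
  edge : ∀ x y z, x ≠ y → z ≠ y → (S.graph K).dist x z = 1 → S.d y x z ≤ C
  path : ∀ x y z, x ≠ y → z ≠ y → ∀ w : (S.graph K).Walk x z,
    (∀ a ∈ w.support, 2 < (S.graph K).dist y a) → S.d y x z ≤ C
  geodesic : ∀ x y z, x ≠ y → z ≠ y → ∀ w : (S.graph K).Walk x z,
    w.length = (S.graph K).dist x z → y ∉ w.support → S.d y x z ≤ C

theorem IsProjectionComplex.exists_hasBounds (h : S.IsProjectionComplex K) :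
    ∃ C, S.HasBounds K C := by
  obtain ⟨-, hc, Ce, Cp, Cg, he, hp, hg⟩ := h
  have h1 := le_abs_self Ce
  have h2 := le_abs_self Cp
  have h3 := le_abs_self Cg
  have h4 := abs_nonneg Ce
  have h5 := abs_nonneg Cp
  have h6 := abs_nonneg Cg
  have h7 := S.θ_nonneg
  refine ⟨|Ce| + |Cp| + |Cg| + S.θ, by linarith, hc, ?_, ?_, ?_⟩
  · intro x y z hx hz h
    linarith [he x y z hx hz h]
  · intro x y z hx hz w h
    linarith [hp x y z hx hz w h]
  · intro x y z hx hz w h h'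
    linarith [hg x y z hx hz w h h']

/-! ### Betweenness and bounded projections -/

/-- `b` lies on a geodesic from `a` to `c` in the graph `S.graph K`. -/
def Between (S : ProjectionSystem Y) (K : ℝ) (a b c : Y) : Prop :=
  (S.graph K).dist a b + (S.graph K).dist b c = (S.graph K).dist a c

namespace HasBounds

variable (hC : S.HasBounds K C)

include hC

theorem nonneg : 0 ≤ C := S.θ_nonneg.trans hC.θ_le

theorem dist_triangle (a b c : Y) :
    (S.graph K).dist a c ≤ (S.graph K).dist a b + (S.graph K).dist b c := by
  obtain ⟨p, hp⟩ := (hC.preconnected a b).exists_walk_length_eq_dist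
  obtain ⟨q, hq⟩ := (hC.preconnected b c).exists_walk_length_eq_dist
  have := SimpleGraph.dist_le (p.append q)
  rw [SimpleGraph.Walk.length_append] at this
  omega

theorem eq_of_dist_eq_zero {a b : Y} (h : (S.graph K).dist a b = 0) : a = b :=
  (hC.preconnected a b).dist_eq_zero_iff.1 h

theorem between_of_mem_support {a b v : Y} (w : (S.graph K).Walk a b)
    (hw : w.length = (S.graph K).dist a b) (hv : v ∈ w.support) : S.Between K a v b := by
  classical
  have h1 := SimpleGraph.dist_le (w.takeUntil v hv)
  have h2 := SimpleGraph.dist_le (w.dropUntil v hv)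
  have h3 := congrArg SimpleGraph.Walk.length (w.take_spec hv)
  rw [SimpleGraph.Walk.length_append] at h3
  have h4 := hC.dist_triangle a v b
  unfold Between
  omega

theorem le_of_not_between {a b v : Y} (h : ¬ S.Between K a v b) : S.d v a b ≤ C := by
  obtain ⟨w, hw⟩ := (hC.preconnected a b).exists_walk_length_eq_dist
  refine hC.geodesic a v b ?_ ?_ w hw (fun hv => h (hC.between_of_mem_support w hw hv))
  · rintro rfl
    exact h (by simp [Between])
  · rintro rfl
    exact h (by simp [Between])

/-- A geodesic from `a` to `b` stops short of `v`, so the geodesic bound applies. -/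
theorem le_of_between {a b v : Y} (h : S.Between K a b v) (hne : b ≠ v) : S.d v a b ≤ C := by
  refine hC.le_of_not_between fun h' => hne (hC.eq_of_dist_eq_zero ?_)
  unfold Between at h h'
  have := (S.graph K).dist_comm (u := v) (v := b)
  omega

theorem le_of_between' {a b v : Y} (h : S.Between K v b a) (hne : b ≠ v) : S.d v b a ≤ C := by
  refine hC.le_of_not_between fun h' => hne (hC.eq_of_dist_eq_zero ?_)
  unfold Between at h h'
  have := (S.graph K).dist_comm (u := v) (v := b)
  omega

theorem le_self {a v : Y} (h : a ≠ v) : S.d v a a ≤ C :=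
  hC.le_of_between (by simp [Between]) h

/-- A vertex `v` with large projection lies on every geodesic, before or after a given vertex. -/
theorem between_cases {a b u v : Y} (h : S.Between K a u b) (ha : a ≠ v) (hb : b ≠ v)
    (hv : C < S.d v a b) : S.Between K a v u ∨ S.Between K u v b := by
  by_contra hcon
  push Not at hcon
  obtain ⟨p, hp⟩ := (hC.preconnected a u).exists_walk_length_eq_dist
  obtain ⟨q, hq⟩ := (hC.preconnected u b).exists_walk_length_eq_dist
  refine absurd (hC.geodesic a v b ha hb (p.append q) ?_ ?_) (not_le.2 hv)
  · rw [SimpleGraph.Walk.length_append, hp, hq]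
    exact h
  · rw [SimpleGraph.Walk.mem_support_append_iff]
    rintro (h' | h')
    · exact hcon.1 (hC.between_of_mem_support p hp h')
    · exact hcon.2 (hC.between_of_mem_support q hq h')

theorem between_right {a b u v : Y} (h : S.Between K a u b) (h' : S.Between K a v u) :
    S.Between K v u b := by
  unfold Between at *
  have h1 := hC.dist_triangle a v b
  have h2 := hC.dist_triangle v u b
  omega

theorem between_left {a b u v : Y} (h : S.Between K a v u) (h' : S.Between K v b u) :
    S.Between K a b u := by
  unfold Between at *
  have h1 := hC.dist_triangle a b u
  have h2 := hC.dist_triangle a v b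
  omega

/-- Behrstock's inequality. -/
theorem le_of_lt {x y z : Y} (hxy : x ≠ y) (hxz : x ≠ z) (hyz : y ≠ z) (h : C < S.d y x z) :
    S.d z y x ≤ C := by
  rw [S.symm z _ _ hyz hxz]
  rcases min_le_iff.1 (S.triples x y z hxy hxz hyz) with h' | h'
  · linarith [hC.θ_le]
  · linarith [hC.θ_le]

end HasBounds

/-! ### Neighbourhoods and connected sets of vertices -/

/-- The set of vertices at distance at most one from `A`. -/
def nbhd (S : ProjectionSystem Y) (K : ℝ) (A : Set Y) : Set Y :=
  {y | ∃ a ∈ A, a = y ∨ (S.graph K).Adj a y}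

theorem subset_nbhd (A : Set Y) : A ⊆ S.nbhd K A := fun a ha => ⟨a, ha, Or.inl rfl⟩

/-- Some path from `a` to `b` stays in the set `A`. -/
def JoinedIn (S : ProjectionSystem Y) (K : ℝ) (A : Set Y) (a b : Y) : Prop :=
  ∃ w : (S.graph K).Walk a b, ∀ c ∈ w.support, c ∈ A

theorem JoinedIn.mono {A B : Set Y} (h : A ⊆ B) {a b : Y} (hj : S.JoinedIn K A a b) :
    S.JoinedIn K B a b := hj.imp fun _ hw c hc => h (hw c hc)

theorem JoinedIn.symm {A : Set Y} {a b : Y} (hj : S.JoinedIn K A a b) : S.JoinedIn K A b a := by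
  obtain ⟨w, hw⟩ := hj
  exact ⟨w.reverse, fun c hc => hw c (by simpa using hc)⟩

theorem JoinedIn.trans {A : Set Y} {a b c : Y} (h : S.JoinedIn K A a b)
    (h' : S.JoinedIn K A b c) : S.JoinedIn K A a c := by
  obtain ⟨w, hw⟩ := h
  obtain ⟨w', hw'⟩ := h'
  refine ⟨w.append w', fun d hd => ?_⟩
  rcases (SimpleGraph.Walk.mem_support_append_iff _ _).1 hd with hd | hd
  exacts [hw d hd, hw' d hd]

theorem JoinedIn.refl {A : Set Y} {a : Y} (h : a ∈ A) : S.JoinedIn K A a a :=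
  ⟨.nil, fun c hc => by simp at hc; rwa [hc]⟩

theorem joinedIn_nbhd {A : Set Y} {x : Y} (h : ∀ a ∈ A, S.JoinedIn K A x a) :
    ∀ b ∈ S.nbhd K A, S.JoinedIn K (S.nbhd K A) x b := by
  rintro b ⟨a, ha, rfl | hab⟩
  · exact (h a ha).mono (subset_nbhd A)
  · refine ((h a ha).mono (subset_nbhd A)).trans ⟨.cons hab .nil, ?_⟩
    intro c hc
    simp only [SimpleGraph.Walk.support_cons, SimpleGraph.Walk.support_nil, List.mem_cons,
      List.not_mem_nil, or_false] at hc
    rcases hc with rfl | rfl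
    exacts [subset_nbhd A ha, ⟨a, ha, Or.inr hab⟩]

namespace HasBounds

variable (hC : S.HasBounds K C)

include hC

theorem nbhd_le {A : Set Y} {y v : Y} (hy : y ∈ S.nbhd K A) (hv : v ∉ A) (hyv : y ≠ v) :
    ∃ a ∈ A, S.d v a y ≤ C := by
  obtain ⟨a, ha, rfl | h⟩ := hy
  · exact ⟨a, ha, hC.le_self hyv⟩
  · exact ⟨a, ha, hC.edge _ _ _ (fun e => hv (e ▸ ha)) hyv (SimpleGraph.dist_eq_one_iff_adj.2 h)⟩

theorem nbhd_nbhd_le {A : Set Y} {y z v : Y} {M : ℝ} (hy : y ∈ S.nbhd K A)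
    (hz : z ∈ S.nbhd K A) (hv : v ∉ A) (hyv : y ≠ v) (hzv : z ≠ v)
    (hA : ∀ a ∈ A, ∀ b ∈ A, S.d v a b ≤ M) : S.d v y z ≤ M + 2 * C := by
  obtain ⟨a, ha, h1⟩ := hC.nbhd_le hy hv hyv
  obtain ⟨b, hb, h2⟩ := hC.nbhd_le hz hv hzv
  have ha' : a ≠ v := fun e => hv (e ▸ ha)
  have hb' : b ≠ v := fun e => hv (e ▸ hb)
  have h3 := S.triangle v y a z hyv ha' hzv
  have h4 := S.triangle v a b z ha' hb' hzv
  have h5 := S.symm v a y ha' hyv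
  linarith [hA a ha b hb]

/-- Connected sets have bounded projection to vertices at distance greater than two. -/
theorem le_of_notMem_nbhd {A : Set Y} {u a b : Y} (hu : u ∉ S.nbhd K (S.nbhd K A))
    (hab : S.JoinedIn K A a b) : S.d u a b ≤ C := by
  obtain ⟨w, hw⟩ := hab
  have hu' : u ∉ A := fun h => hu (subset_nbhd _ (subset_nbhd _ h))
  refine hC.path a u b (fun e => hu' (e ▸ hw _ w.start_mem_support))
    (fun e => hu' (e ▸ hw _ w.end_mem_support)) w fun c hc => ?_
  by_contra hlt
  obtain ⟨p, hp⟩ := (hC.preconnected c u).exists_walk_length_eq_dist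
  rw [SimpleGraph.dist_comm] at hp
  have hcA := hw c hc
  -- A geodesic from `c` to `u` with at most two edges would put `u` in the second neighbourhood of
  -- `A`.
  match p, hp with
  | .nil, _ => exact hu' hcA
  | .cons h .nil, _ => exact hu (subset_nbhd _ ⟨_, hcA, Or.inr h⟩)
  | .cons h (.cons h' .nil), _ => exact hu ⟨_, ⟨_, hcA, Or.inr h⟩, Or.inr h'⟩
  | .cons _ (.cons _ (.cons _ q)), hp =>
    simp only [SimpleGraph.Walk.length_cons] at hp
    omega

end HasBounds

end ProjectionSystem

namespace ProjectionSystem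

variable {Y : Type u} {S : ProjectionSystem Y} {K C L : ℝ}
variable {G : Type v} [Group G] [MulAction G Y] {R : Y → Subgroup G}

/-! ### Translation invariance -/

theorem IsInvariant.dist_smul_le (hG : S.IsInvariant G) (hC : S.HasBounds K C) (g : G) (a b : Y) :
    (S.graph K).dist (g • a) (g • b) ≤ (S.graph K).dist a b := by
  obtain ⟨p, hp⟩ := (hC.preconnected a b).exists_walk_length_eq_dist
  let f : S.graph K →g S.graph K := ⟨fun x => g • x, fun h => hG.adj_smul g h⟩
  have := SimpleGraph.dist_le (p.map f)
  rw [SimpleGraph.Walk.length_map, hp] at this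
  exact this

theorem IsInvariant.dist_smul (hG : S.IsInvariant G) (hC : S.HasBounds K C) (g : G) (a b : Y) :
    (S.graph K).dist (g • a) (g • b) = (S.graph K).dist a b := by
  refine le_antisymm (hG.dist_smul_le hC g a b) ?_
  simpa using hG.dist_smul_le hC g⁻¹ (g • a) (g • b)

theorem IsInvariant.between_smul (hG : S.IsInvariant G) (hC : S.HasBounds K C) (g : G)
    {a b c : Y} (h : S.Between K a b c) : S.Between K (g • a) (g • b) (g • c) := by
  unfold Between at *
  rwa [hG.dist_smul hC, hG.dist_smul hC, hG.dist_smul hC]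

theorem smul_mem_nbhd (hG : S.IsInvariant G) {A : Set Y} {g : G} (hg : ∀ a ∈ A, g • a ∈ A)
    {y : Y} (hy : y ∈ S.nbhd K A) : g • y ∈ S.nbhd K A := by
  obtain ⟨a, ha, rfl | h⟩ := hy
  · exact ⟨_, hg a ha, Or.inl rfl⟩
  · exact ⟨_, hg a ha, Or.inr (hG.adj_smul g h)⟩

theorem JoinedIn.smul (hG : S.IsInvariant G) {A : Set Y} {g : G} (hg : ∀ a ∈ A, g • a ∈ A)
    {a b : Y} (h : S.JoinedIn K A a b) : S.JoinedIn K A (g • a) (g • b) := by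
  obtain ⟨w, hw⟩ := h
  let f : S.graph K →g S.graph K := ⟨fun x => g • x, fun h => hG.adj_smul g h⟩
  refine ⟨w.map f, fun c hc => ?_⟩
  rw [SimpleGraph.Walk.support_map] at hc
  obtain ⟨d, hd, rfl⟩ := List.mem_map.1 hc
  exact hg d (hw d hd)

namespace IsSpinningFamily

variable (hR : S.IsSpinningFamily L R)

include hR

theorem smul_self {v : Y} {s : G} (hs : s ∈ R v) : s • v = v := hR.le_stabilizer v hs

theorem conj_mem (g : G) {v : Y} {s : G} (hs : s ∈ R v) : g * s * g⁻¹ ∈ R (g • v) := by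
  rw [← hR.equivariant g v]
  exact ⟨s, hs, rfl⟩

end IsSpinningFamily

/-! ### Reduced words -/

/-- `Reduced R V A o y`: the vertex `y` is `s₁ ⋯ sₘ • w` with `w ∈ A`, with nontrivial `sⱼ ∈ R vⱼ`
and `vⱼ ∈ V`, where consecutive vertices `vⱼ` differ, and `o` is the first vertex `v₁`, if any. -/
inductive Reduced (R : Y → Subgroup G) (V A : Set Y) : Option Y → Y → Prop
  | nil {w : Y} : w ∈ A → Reduced R V A none w
  | cons {o : Option Y} {y v : Y} {s : G} : v ∈ V → s ∈ R v → s ≠ 1 → o ≠ some v →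
      Reduced R V A o y → Reduced R V A (some v) (s • y)

namespace Reduced

variable {V A : Set Y}

theorem mem {v y : Y} (h : Reduced R V A (some v) y) : v ∈ V := by
  generalize ho : some v = o at h
  cases h with
  | nil => cases ho
  | cons hv =>
    cases ho
    exact hv

/-- The new letter is prepended, or merged with a first letter attached to the same vertex. If the
merged letter is trivial, what remains is the reduced tail. -/
theorem smul_of_mem {o : Option Y} {y v : Y} {s : G} (hv : v ∈ V) (hs : s ∈ R v)
    (h : Reduced R V A o y) : ∃ o, Reduced R V A o (s • y) := by
  by_cases h1 : s = 1
  · exact ⟨o, by rwa [h1, one_smul]⟩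
  by_cases ho : o = some v
  · subst ho
    cases h with
    | @cons o y _ t _ ht _ ho h =>
      rw [← mul_smul]
      by_cases h2 : s * t = 1
      · exact ⟨o, by rwa [h2, one_smul]⟩
      · exact ⟨_, .cons hv (mul_mem hs ht) h2 ho h⟩
  · exact ⟨_, .cons hv hs h1 ho h⟩

/-- Moving `g` through the word conjugates each letter, and equivariance puts the conjugate in the
group of the translated vertex. The length of the word is unchanged. -/
theorem smul (hR : S.IsSpinningFamily L R) {g : G} (hV : ∀ v ∈ V, g • v ∈ V)
    (hA : ∀ a ∈ A, g • a ∈ A) {o : Option Y} {y : Y} (h : Reduced R V A o y) :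
    Reduced R V A (o.map (g • ·)) (g • y) := by
  induction h with
  | nil hw => exact .nil (hA _ hw)
  | @cons o y v s hv hs h1 ho _ ih =>
    have e : g • s • y = (g * s * g⁻¹) • g • y := by simp [mul_smul]
    rw [e]
    refine .cons (hV v hv) (hR.conj_mem g hs) (fun h => h1 ?_) (fun h => ho ?_) ih
    · exact conj_eq_one_iff.1 h
    · cases o with
      | none => simp at h
      | some w => simpa using h

end Reduced

/-! ### Ping-pong -/

/-- The projections of `W` to vertices outside of `W` have diameter at most `M`. -/
def ProjBounded (S : ProjectionSystem Y) (W : Set Y) (M : ℝ) : Prop :=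
  ∀ v, v ∉ W → ∀ a ∈ W, ∀ b ∈ W, S.d v a b ≤ M

variable {W A : Set Y}

theorem ProjBounded.nbhd_le (hC : S.HasBounds K C) (hW : S.ProjBounded W (13 * C))
    {p v z : Y} (hp : p ∈ W) (hv : v ∉ W) (hz : z ∈ S.nbhd K W) (hzv : z ≠ v) :
    S.d v p z ≤ 14 * C := by
  obtain ⟨a, ha, h⟩ := hC.nbhd_le hz hv hzv
  have := S.triangle v p a z (fun e => hv (e ▸ hp)) (fun e => hv (e ▸ ha)) hzv
  linarith [hW v hv p hp a ha]

/-- Nontrivial elements of `R v` move vertices with small projection to large ones. -/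
theorem IsSpinningFamily.le_smul (hR : S.IsSpinningFamily L R) {p y v : Y} {s : G}
    (hs : s ∈ R v) (h1 : s ≠ 1) (hp : p ≠ v) (hy : y ≠ v) {M : ℝ} (h : S.d v p y ≤ M) :
    s • y ≠ v ∧ L - M ≤ S.d v p (s • y) := by
  have hy' : s • y ≠ v := fun e => hy (by
    rw [← hR.smul_self hs] at e
    exact MulAction.injective s e)
  refine ⟨hy', ?_⟩
  have h2 := hR.spinning v y hy.symm s hs h1
  have h3 := S.triangle v y p (s • y) hy hp hy'
  rw [S.symm v y p hy hp] at h3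
  linarith

/-- By induction, the tail projects near `W` at the first vertex `v'`, so the first letter throws it
at least `L - 15 * C` away there. Any other `v` in the neighbourhood stays within `14 * C` of `W` as
seen from `v'`. Behrstock's inequality then makes the endpoint and `v'` look close from `v`, and `14
* C + C = 15 * C` closes the induction. -/
theorem Reduced.pingpong (hC : S.HasBounds K C) (hR : S.IsSpinningFamily L R)
    (hL : 40 * C < L) (hW : S.ProjBounded W (13 * C)) (hA : A ⊆ W) {o : Option Y} {y : Y}
    (h : Reduced R (S.nbhd K W \ W) A o y) :
    ∀ v ∈ S.nbhd K W \ W, o ≠ some v → y ≠ v ∧ ∀ p ∈ W, S.d v p y ≤ 15 * C := by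
  have h0 := hC.nonneg
  induction h with
  | nil hw =>
    intro v hv _
    refine ⟨fun e => hv.2 (e ▸ hA hw), fun p hp => ?_⟩
    linarith [hW v hv.2 p hp _ (hA hw)]
  | @cons o y v' s hv' hs h1 ho h ih =>
    intro v hv hne
    have hne : v' ≠ v := fun e => hne (by rw [e])
    obtain ⟨hy, hd⟩ := ih v' hv' ho
    have key : ∀ p ∈ W, s • y ≠ v' ∧ L - 15 * C ≤ S.d v' p (s • y) := fun p hp =>
      hR.le_smul hs h1 (fun e => hv'.2 (e ▸ hp)) hy (hd p hp)
    obtain ⟨w, hw, -⟩ := hv.1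
    have hsy := (key w hw).1
    have hwv : w ≠ v := fun e => hv.2 (e ▸ hw)
    have hwv' : w ≠ v' := fun e => hv'.2 (e ▸ hw)
    have h3 := hW.nbhd_le hC hw hv'.2 hv.1 hne.symm
    have hyv : s • y ≠ v := by
      intro e
      have := (key w hw).2
      rw [e] at this
      linarith
    refine ⟨hyv, fun p hp => ?_⟩
    have hpv : p ≠ v := fun e => hv.2 (e ▸ hp)
    have h4 := S.triangle v' w v (s • y) hwv' hne.symm hsy
    have h5 : C < S.d v' v (s • y) := by linarith [(key w hw).2]
    rw [S.symm v' v (s • y) hne.symm hsy] at h5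
    have h6 := hC.le_of_lt hsy hyv hne h5
    have h7 := S.triangle v p v' (s • y) hpv hne hyv
    have h8 := hW.nbhd_le hC hp hv.2 hv'.1 hne
    linarith

/-- A reduced word moves `A` to vertices with large projection to its first vertex. -/
theorem Reduced.le_of_cons (hC : S.HasBounds K C) (hR : S.IsSpinningFamily L R)
    (hL : 40 * C < L) (hW : S.ProjBounded W (13 * C)) (hA : A ⊆ W) {o : Option Y} {y v : Y}
    {s : G} (hv : v ∈ S.nbhd K W \ W) (hs : s ∈ R v) (h1 : s ≠ 1) (ho : o ≠ some v)
    (h : Reduced R (S.nbhd K W \ W) A o y) :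
    s • y ≠ v ∧ ∀ p ∈ W, L - 15 * C ≤ S.d v p (s • y) := by
  obtain ⟨hy, hd⟩ := h.pingpong hC hR hL hW hA v hv ho
  obtain ⟨w, hw, -⟩ := hv.1
  have key : ∀ p ∈ W, s • y ≠ v ∧ L - 15 * C ≤ S.d v p (s • y) := fun p hp =>
    hR.le_smul hs h1 (fun e => hv.2 (e ▸ hp)) hy (hd p hp)
  exact ⟨(key w hw).1, fun p hp => (key p hp).2⟩

theorem Reduced.lt_of_cons (hC : S.HasBounds K C) (hR : S.IsSpinningFamily L R)
    (hL : 40 * C < L) (hW : S.ProjBounded W (13 * C)) (hA : A ⊆ W) {o : Option Y} {y v z : Y}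
    {s : G} (hv : v ∈ S.nbhd K W \ W) (hs : s ∈ R v) (h1 : s ≠ 1) (ho : o ≠ some v)
    (h : Reduced R (S.nbhd K W \ W) A o y) (hz : z ∈ S.nbhd K W) (hzv : z ≠ v) :
    C < S.d v z (s • y) := by
  have h0 := hC.nonneg
  obtain ⟨hy, hd⟩ := h.le_of_cons hC hR hL hW hA hv hs h1 ho
  obtain ⟨w, hw, -⟩ := hv.1
  have hwv : w ≠ v := fun e => hv.2 (e ▸ hw)
  have h2 := S.triangle v w z (s • y) hwv hzv hy
  linarith [hd w hw, hW.nbhd_le hC hw hv.2 hz hzv]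

/-- A vertex far from the orbit of `W` which lies on a geodesic from `z₀` to the endpoint of a
reduced word lies between two consecutive vertices of the chain given by the word. -/
theorem Reduced.exists_between (hC : S.HasBounds K C) (hG : S.IsInvariant G)
    (hR : S.IsSpinningFamily L R) (hL : 40 * C < L) (hW : S.ProjBounded W (13 * C))
    {N : Subgroup G} (hN : ∀ v ∈ S.nbhd K W, R v ≤ N) {M : ℝ} {o : Option Y} {y : Y}
    (h : Reduced R (S.nbhd K W \ W) W o y) : ∀ u,
    (∀ g ∈ N, g • u ∉ S.nbhd K W) → (∀ g ∈ N, ∀ a ∈ W, ∀ b ∈ W, S.d (g • u) a b ≤ M) →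
    ∀ z₀ ∈ S.nbhd K W, o ≠ some z₀ → S.Between K z₀ u y →
    ∃ z z', z ≠ u ∧ z' ≠ u ∧ S.d u z z' ≤ M + 2 * C ∧ S.Between K z₀ z u ∧
      S.Between K u z' y := by
  induction h with
  | @nil w hw =>
    intro u hu hM z₀ hz₀ _ _
    have hu1 : u ∉ S.nbhd K W := by simpa using hu 1 N.one_mem
    have hz : z₀ ≠ u := fun e => hu1 (e ▸ hz₀)
    have hwu : w ≠ u := fun e => hu1 (e ▸ subset_nbhd _ hw)
    refine ⟨z₀, w, hz, hwu, ?_, by simp [Between], by simp [Between]⟩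
    exact hC.nbhd_nbhd_le hz₀ (subset_nbhd _ hw) (fun h => hu1 (subset_nbhd _ h)) hz hwu
      (by simpa using hM 1 N.one_mem)
  | @cons o y v s hv hs h1 ho h ih =>
    intro u hu hM z₀ hz₀ hzv hb
    have hu1 : u ∉ S.nbhd K W := by simpa using hu 1 N.one_mem
    have hz : z₀ ≠ u := fun e => hu1 (e ▸ hz₀)
    have hvu : v ≠ u := fun e => hu1 (e ▸ hv.1)
    have hzv : z₀ ≠ v := fun e => hzv (by rw [e])
    have hlt := h.lt_of_cons hC hR hL hW subset_rfl hv hs h1 ho hz₀ hzv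
    have hsy := (h.le_of_cons hC hR hL hW subset_rfl hv hs h1 ho).1
    -- Every geodesic from `z₀` to the endpoint passes through the first rotation vertex `v`. If `u`
    -- comes after `v`, undo the rotation, which fixes `v`, and recurse with `v` as the new initial
    -- vertex; if `u` comes before `v`, the pair `z₀`, `v` serves.
    rcases hC.between_cases hb hzv hsy hlt with hb' | hb'
    · have hb2 := hC.between_right hb hb'
      have hsN : s⁻¹ ∈ N := N.inv_mem (hN v hv.1 hs)
      have hb3 := hG.between_smul hC s⁻¹ hb2
      rw [inv_smul_smul, hR.smul_self ((R v).inv_mem hs)] at hb3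
      obtain ⟨z, z', hzu, hzu', hd, h4, h5⟩ := ih (s⁻¹ • u)
        (fun g hg => by rw [← mul_smul]; exact hu _ (N.mul_mem hg hsN))
        (fun g hg => by rw [← mul_smul]; exact hM _ (N.mul_mem hg hsN)) v hv.1 ho hb3
      have h4' := hG.between_smul hC s h4
      have h5' := hG.between_smul hC s h5
      rw [smul_inv_smul] at h4' h5'
      rw [hR.smul_self hs] at h4'
      refine ⟨s • z, s • z', fun e => hzu (by rw [← e, inv_smul_smul]),
        fun e => hzu' (by rw [← e, inv_smul_smul]), ?_, hC.between_left hb' h4', h5'⟩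
      have := hG s _ _ _ hzu hzu'
      rw [smul_inv_smul] at this
      rwa [this]
    · refine ⟨z₀, v, hz, hvu, ?_, by simp [Between], hb'⟩
      exact hC.nbhd_nbhd_le hz₀ hv.1 (fun h => hu1 (subset_nbhd _ h)) hz hvu
        (by simpa using hM 1 N.one_mem)

/-! ### The windmill -/

/-- The subgroup generated by the subgroups `R v` with `v ∈ A`. -/
def setSpan (R : Y → Subgroup G) (A : Set Y) : Subgroup G :=
  Subgroup.closure {g | ∃ v ∈ A, g ∈ R v}

omit [MulAction G Y] in
theorem le_setSpan {A : Set Y} {v : Y} (hv : v ∈ A) : R v ≤ setSpan R A :=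
  fun _ hg => Subgroup.subset_closure ⟨v, hv, hg⟩

/-- The next stage of a windmill: the orbit of the neighbourhood of `W` under the subgroup
generated by the subgroups attached to its vertices. -/
def expand (S : ProjectionSystem Y) (K : ℝ) (R : Y → Subgroup G) (W : Set Y) : Set Y :=
  {y | ∃ g ∈ setSpan R (S.nbhd K W), ∃ n ∈ S.nbhd K W, g • n = y}

theorem nbhd_subset_expand : S.nbhd K W ⊆ S.expand K R W :=
  fun n hn => ⟨1, one_mem _, n, hn, one_smul _ _⟩

theorem smul_mem_expand {g : G} (hg : g ∈ setSpan R (S.nbhd K W)) {y : Y}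
    (hy : y ∈ S.expand K R W) : g • y ∈ S.expand K R W := by
  obtain ⟨h, hh, n, hn, rfl⟩ := hy
  exact ⟨g * h, mul_mem hg hh, n, hn, mul_smul _ _ _⟩

theorem smul_mem_expand_iff {g : G} (hg : g ∈ setSpan R (S.nbhd K W)) {y : Y} :
    g • y ∈ S.expand K R W ↔ y ∈ S.expand K R W :=
  ⟨fun h => by simpa using smul_mem_expand (inv_mem hg) h, smul_mem_expand hg⟩

/-- The properties kept along the stages of a windmill: the subgroup `N` preserves the connected
set `W` and contains the subgroups attached to the vertices of `W`. -/
structure Stage (S : ProjectionSystem Y) (K : ℝ) (R : Y → Subgroup G) (x : Y) (W : Set Y)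
    (N : Subgroup G) : Prop where
  mem : x ∈ W
  smul_mem : ∀ g ∈ N, ∀ a ∈ W, g • a ∈ W
  le : ∀ v ∈ W, R v ≤ N
  joined : ∀ a ∈ W, S.JoinedIn K W x a

/-- It suffices to treat one generator at a time. Generators attached to vertices of `W` lie in `N`
and are absorbed by conjugation; the others become letters of the word. -/
theorem Stage.reduced_smul {x : Y} {N : Subgroup G} (hS : S.Stage K R x W N)
    (hG : S.IsInvariant G) (hR : S.IsSpinningFamily L R) (hA : ∀ g ∈ N, ∀ a ∈ A, g • a ∈ A)
    {g : G} (hg : g ∈ setSpan R (S.nbhd K W)) {o : Option Y} {y : Y}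
    (h : Reduced R (S.nbhd K W \ W) A o y) : ∃ o, Reduced R (S.nbhd K W \ W) A o (g • y) := by
  have hV : ∀ g ∈ N, ∀ v ∈ S.nbhd K W \ W, g • v ∈ S.nbhd K W \ W := fun g hg v hv =>
    ⟨smul_mem_nbhd hG (hS.smul_mem g hg) hv.1, fun h => hv.2 (by
      simpa using hS.smul_mem _ (N.inv_mem hg) _ h)⟩
  have key : ∀ g, (∃ v ∈ S.nbhd K W, g ∈ R v) → ∀ o y, Reduced R (S.nbhd K W \ W) A o y →
      ∃ o, Reduced R (S.nbhd K W \ W) A o (g • y) := by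
    rintro g ⟨v, hv, hgv⟩ o y h
    by_cases hvW : v ∈ W
    · have hgN := hS.le v hvW hgv
      exact ⟨_, h.smul hR (hV g hgN) (hA g hgN)⟩
    · exact h.smul_of_mem ⟨hv, hvW⟩ hgv
  induction hg using Subgroup.closure_induction_left with
  | one => exact ⟨o, by rwa [one_smul]⟩
  | mul_left g hg g' _ ih =>
    obtain ⟨o', h'⟩ := ih
    rw [mul_smul]
    exact key g hg o' _ h'
  | inv_mul_cancel g hg g' _ ih =>
    obtain ⟨o', h'⟩ := ih
    rw [mul_smul]
    obtain ⟨v, hv, hgv⟩ := hg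
    exact key g⁻¹ ⟨v, hv, inv_mem hgv⟩ o' _ h'

theorem Stage.expand {x : Y} {N : Subgroup G} (hS : S.Stage K R x W N) (hG : S.IsInvariant G)
    (hR : S.IsSpinningFamily L R) :
    S.Stage K R x (S.expand K R W) (setSpan R (S.nbhd K W)) where
  mem := nbhd_subset_expand (subset_nbhd _ hS.mem)
  smul_mem g hg a ha := smul_mem_expand hg ha
  le := by
    rintro v ⟨g, hg, n, hn, rfl⟩ s hs
    have h := le_setSpan (R := R) hn (by simpa using hR.conj_mem g⁻¹ hs : g⁻¹ * s * g ∈ R n)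
    have e : s = g * (g⁻¹ * s * g) * g⁻¹ := by group
    rw [e]
    exact mul_mem (mul_mem hg h) (inv_mem hg)
  joined := by
    have h1 : ∀ n ∈ S.nbhd K W, S.JoinedIn K (S.expand K R W) x n := fun n hn =>
      (joinedIn_nbhd hS.joined n hn).mono nbhd_subset_expand
    have h2 : ∀ g ∈ setSpan R (S.nbhd K W), S.JoinedIn K (S.expand K R W) x (g • x) := by
      intro g hg
      induction hg using Subgroup.closure_induction with
      | mem g hg =>
        obtain ⟨v, hv, hgv⟩ := hg
        -- The rotation `g` fixes `v`, so a path from `x` to `v` followed by its reversed image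
        -- under `g` joins `x` to `g • x`.
        have h3 := (h1 v hv).smul hG (fun a => smul_mem_expand (le_setSpan hv hgv))
        rw [hR.smul_self hgv] at h3
        exact (h1 v hv).trans h3.symm
      | one =>
        rw [one_smul]
        exact .refl (nbhd_subset_expand (subset_nbhd _ hS.mem))
      | mul g g' hg _ ih ih' =>
        rw [mul_smul]
        exact ih.trans (ih'.smul hG fun a => smul_mem_expand hg)
      | inv g hg ih =>
        have h3 := ih.smul hG (fun a => smul_mem_expand (inv_mem hg))
        rw [inv_smul_smul] at h3
        exact h3.symm
    rintro a ⟨g, hg, n, hn, rfl⟩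
    exact (h2 g hg).trans ((h1 n hn).smul hG fun a => smul_mem_expand hg)

/-- Projection bounds for one stage of a windmill give projection bounds for the next one. -/
theorem Stage.le_expand {x : Y} {N : Subgroup G} (hS : S.Stage K R x W N) (hC : S.HasBounds K C)
    (hG : S.IsInvariant G) (hR : S.IsSpinningFamily L R) (hL : 40 * C < L)
    (hW : S.ProjBounded W (13 * C)) {M : ℝ} {u : Y} (hu : u ∉ S.expand K R W)
    (hM : ∀ g ∈ setSpan R (S.nbhd K W), ∀ a ∈ W, ∀ b ∈ W, S.d (g • u) a b ≤ M) :
    ∀ a ∈ S.expand K R W, ∀ b ∈ S.expand K R W, S.d u a b ≤ M + 6 * C := by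
  have h0 := hC.nonneg
  have hne : ∀ {a v}, v ∉ S.expand K R W → a ∈ S.expand K R W → a ≠ v :=
    fun hv ha e => hv (e ▸ ha)
  have hsub : W ⊆ S.expand K R W := (subset_nbhd W).trans nbhd_subset_expand
  have hM0 : 0 ≤ M := by
    have hxu := hne hu (hsub hS.mem)
    have h1 := hM 1 (one_mem _) x hS.mem x hS.mem
    rw [one_smul] at h1
    exact (S.nonneg u x x hxu hxu).trans h1
  have key : ∀ p ∈ W, ∀ p' ∈ W, ∀ g ∈ setSpan R (S.nbhd K W), ∀ u, u ∉ S.expand K R W →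
      (∀ g ∈ setSpan R (S.nbhd K W), ∀ a ∈ W, ∀ b ∈ W, S.d (g • u) a b ≤ M) →
      S.d u p (g • p') ≤ M + 4 * C := by
    intro p hp p' hp' g hg u hu hM
    have hpu := hne hu (hsub hp)
    have hyu := hne hu (smul_mem_expand hg (hsub hp'))
    -- If `u` is on a geodesic, the chain of the word gives a pair around `u` at projection distance
    -- at most `M + 2 * C`, and each end of the geodesic adds `C`. Otherwise the projection is at
    -- most `C`.
    by_cases hb : S.Between K p u (g • p')
    · obtain ⟨o, ho⟩ := hS.reduced_smul hG hR hS.smul_mem hg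
        (.nil hp' : Reduced R (S.nbhd K W \ W) W none p')
      have hop : o ≠ some p := by
        rintro rfl
        exact ho.mem.2 hp
      obtain ⟨z, z', hz, hz', hd, h1, h2⟩ := ho.exists_between hC hG hR hL hW
        (fun v hv => le_setSpan hv) u
        (fun g hg h => hu ((smul_mem_expand_iff hg).1 (nbhd_subset_expand h))) hM p
        (subset_nbhd _ hp) hop hb
      have h3 := S.triangle u p z (g • p') hpu hz hyu
      have h4 := S.triangle u z z' (g • p') hz hz' hyu
      have h5 := hC.le_of_between h1 hz
      have h6 := hC.le_of_between' h2 hz'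
      linarith
    · linarith [hC.le_of_not_between hb]
  rintro a ⟨g, hg, n, hn, rfl⟩ b ⟨g', hg', n', hn', rfl⟩
  have hu' : g⁻¹ • u ∉ S.expand K R W := fun h => hu ((smul_mem_expand_iff (inv_mem hg)).1 h)
  have hM' : ∀ h ∈ setSpan R (S.nbhd K W), ∀ a ∈ W, ∀ b ∈ W, S.d (h • g⁻¹ • u) a b ≤ M := by
    intro h hh
    rw [← mul_smul]
    exact hM _ (mul_mem hh (inv_mem hg))
  have hu'' : g'⁻¹ • u ∉ S.expand K R W := fun h => hu ((smul_mem_expand_iff (inv_mem hg')).1 h)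
  -- Replacing `n` and `n'` by nearby points of `W` costs `C` at each end, which turns `M + 4 * C`
  -- into `M + 6 * C`.
  obtain ⟨p, hp, h1⟩ := hC.nbhd_le hn (fun h => hu' (hsub h)) (hne hu' (nbhd_subset_expand hn))
  obtain ⟨p', hp', h2⟩ := hC.nbhd_le hn' (fun h => hu'' (hsub h))
    (hne hu'' (nbhd_subset_expand hn'))
  have h3 := key p hp p' hp' (g⁻¹ * g') (mul_mem (inv_mem hg) hg') _ hu' hM'
  have e1 := hG g (g⁻¹ • u) p n (hne hu' (hsub hp)) (hne hu' (nbhd_subset_expand hn))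
  have e2 := hG g' (g'⁻¹ • u) p' n' (hne hu'' (hsub hp')) (hne hu'' (nbhd_subset_expand hn'))
  have e3 := hG g (g⁻¹ • u) p ((g⁻¹ * g') • p') (hne hu' (hsub hp))
    (hne hu' (smul_mem_expand (mul_mem (inv_mem hg) hg') (hsub hp')))
  rw [smul_inv_smul] at e1 e2 e3
  rw [← mul_smul, mul_inv_cancel_left] at e3
  have hgp := hne hu (smul_mem_expand hg (hsub hp))
  have hgn := hne hu (smul_mem_expand hg (nbhd_subset_expand hn))
  have hgp' := hne hu (smul_mem_expand hg' (hsub hp'))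
  have hgn' := hne hu (smul_mem_expand hg' (nbhd_subset_expand hn'))
  have t1 := S.triangle u (g • n) (g • p) (g' • n') hgn hgp hgn'
  have t2 := S.triangle u (g • p) (g' • p') (g' • n') hgp hgp' hgn'
  have t3 := S.symm u (g • n) (g • p) hgn hgp
  linarith

/-- The stages of the windmill around `x`. -/
def windmill (S : ProjectionSystem Y) (K : ℝ) (R : Y → Subgroup G) (x : Y) : ℕ → Set Y
  | 0 => {x}
  | i + 1 => S.expand K R (windmill S K R x i)

/-- The groups of the stages of the windmill around `x`. -/
def windmillGroup (S : ProjectionSystem Y) (K : ℝ) (R : Y → Subgroup G) (x : Y) : ℕ → Subgroup G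
  | 0 => R x
  | i + 1 => setSpan R (S.nbhd K (S.windmill K R x i))

theorem stage_windmill (hG : S.IsInvariant G) (hR : S.IsSpinningFamily L R) (x : Y) (i : ℕ) :
    S.Stage K R x (S.windmill K R x i) (S.windmillGroup K R x i) := by
  induction i with
  | zero =>
    refine ⟨rfl, ?_, ?_, ?_⟩
    · rintro g hg a rfl
      exact hR.smul_self hg
    · rintro v rfl
      exact le_rfl
    · rintro a rfl
      exact .refl rfl
  | succ i ih => exact ih.expand hG hR

/-- Each expansion adds `6 * C`, but the errors do not accumulate. Seen from a vertex outside stage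
`i + 2`, all relevant translates are more than two steps away from stage `i`. That stage is
connected, so its projection is at most `C` by the path bound. Two expansions then give `C + 6 * C +
6 * C = 13 * C`. -/
theorem projBounded_windmill (hC : S.HasBounds K C) (hG : S.IsInvariant G)
    (hR : S.IsSpinningFamily L R) (hL : 40 * C < L) (x : Y) (i : ℕ) :
    S.ProjBounded (S.windmill K R x i) (13 * C) := by
  have h0 := hC.nonneg
  have hx : ∀ v, v ∉ S.windmill K R x 0 → ∀ a ∈ S.windmill K R x 0,
      ∀ b ∈ S.windmill K R x 0, S.d v a b ≤ C := by
    rintro v hv a rfl b rfl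
    exact hC.le_self fun e => hv e.symm
  induction i using Nat.strong_induction_on with
  | _ i ih =>
    match i, ih with
    | 0, _ => exact fun v hv a ha b hb => by linarith [hx v hv a ha b hb]
    | 1, ih =>
      intro u hu a ha b hb
      have h1 := (stage_windmill (K := K) hG hR x 0).le_expand hC hG hR hL (ih 0 one_pos) hu
        (M := C) (fun g hg => hx _ fun h => hu ((smul_mem_expand_iff hg).1
          (nbhd_subset_expand (subset_nbhd _ h)))) a ha b hb
      linarith
    | i + 2, ih =>
      intro u hu a ha b hb
      have h1 := (stage_windmill (K := K) hG hR x (i + 1)).le_expand hC hG hR hL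
        (ih (i + 1) (by omega)) hu (M := 7 * C) ?_ a ha b hb
      · linarith
      · intro g hg a ha b hb
        have hu' : g • u ∉ S.nbhd K (S.windmill K R x (i + 1)) := fun h =>
          hu ((smul_mem_expand_iff hg).1 (nbhd_subset_expand h))
        have hS := stage_windmill (K := K) hG hR x i
        have h2 := hS.le_expand hC hG hR hL (ih i (by omega))
          (fun h => hu' (subset_nbhd _ h)) (M := C) ?_ a ha b hb
        · linarith
        · intro g' hg' a ha b hb
          refine hC.le_of_notMem_nbhd (fun h => hu' ?_) ((hS.joined a ha).symm.trans
            (hS.joined b hb))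
          -- The second neighbourhood of stage `i` lies in the first neighbourhood of stage `i + 1`,
          -- which is invariant under the group acting here.
          have hgu : g' • g • u ∈ S.nbhd K (S.windmill K R x (i + 1)) := by
            obtain ⟨c, hc, hcu⟩ := h
            exact ⟨c, nbhd_subset_expand hc, hcu⟩
          have := smul_mem_nbhd hG (fun a ha => smul_mem_expand (inv_mem hg') ha) hgu
          rwa [inv_smul_smul] at this

/-! ### Exhaustion by the windmill and shortening -/

theorem mem_windmill (hC : S.HasBounds K C) (R : Y → Subgroup G) (x v : Y) :
    ∃ i, v ∈ S.windmill K R x i := by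
  obtain ⟨w⟩ := hC.preconnected v x
  induction w with
  | nil => exact ⟨0, rfl⟩
  | cons h _ ih =>
    obtain ⟨i, hi⟩ := ih
    exact ⟨i + 1, nbhd_subset_expand ⟨_, hi, Or.inr h.symm⟩⟩

theorem windmillGroup_le (hG : S.IsInvariant G) (hR : S.IsSpinningFamily L R) (x : Y) (i : ℕ) :
    S.windmillGroup K R x i ≤ S.windmillGroup K R x (i + 1) := by
  induction i with
  | zero =>
    change R x ≤ setSpan R (S.nbhd K (S.windmill K R x 0))
    exact le_setSpan (v := x) (subset_nbhd _ (stage_windmill (K := K) hG hR x 0).mem)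
  | succ i _ =>
    change setSpan R (S.nbhd K (S.windmill K R x i)) ≤
      setSpan R (S.nbhd K (S.expand K R (S.windmill K R x i)))
    refine (Subgroup.closure_le _).2 ?_
    rintro g ⟨v, hv, hg⟩
    exact le_setSpan (subset_nbhd _ (nbhd_subset_expand hv)) hg

theorem exists_mem_windmillGroup (hC : S.HasBounds K C) (hG : S.IsInvariant G)
    (hR : S.IsSpinningFamily L R) (x : Y) {h : G} (hh : h ∈ familySpan R) :
    ∃ i, h ∈ S.windmillGroup K R x i := by
  have hmono := monotone_nat_of_le_succ (windmillGroup_le (K := K) hG hR x)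
  unfold familySpan at hh
  induction hh using Subgroup.iSup_induction' with
  | hp v g hg =>
    obtain ⟨i, hi⟩ := mem_windmill hC R x v
    exact ⟨i, (stage_windmill hG hR x i).le v hi hg⟩
  | h1 => exact ⟨0, one_mem _⟩
  | hmul g g' _ _ ih ih' =>
    obtain ⟨i, hi⟩ := ih
    obtain ⟨j, hj⟩ := ih'
    exact ⟨max i j, mul_mem (hmono (le_max_left _ _) hi) (hmono (le_max_right _ _) hj)⟩

/-- Induction by shortening: every vertex of the `H`-orbit of `x` other than `x` has a large
projection to some vertex `v`, and rotating it about `v` makes it simpler. -/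
theorem shortening_induction (hC : S.HasBounds K C) (hG : S.IsInvariant G)
    (hR : S.IsSpinningFamily L R) (hL : 40 * C < L) (x : Y) {P : Y → Prop} (base : P x)
    (step : ∀ y v, ∀ s ∈ R v, x ≠ v → y ≠ v → L - 15 * C ≤ S.d v x y → P (s • y) → P y) :
    ∀ h ∈ familySpan R, P (h • x) := by
  have key : ∀ i, ∀ h ∈ S.windmillGroup K R x i, P (h • x) := by
    intro i
    induction i with
    | zero =>
      intro h hh
      rwa [hR.smul_self hh]
    | succ i ih =>
      intro h hh
      have hS := stage_windmill (K := K) hG hR x i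
      set N := S.windmillGroup K R x i
      set W := S.windmill K R x i
      -- Words are based at the `N`-orbit of `x` instead of all of `W`, so that the empty word is
      -- covered by the hypothesis for the previous stage.
      let A : Set Y := {y | ∃ g ∈ N, g • x = y}
      have hA : ∀ g ∈ N, ∀ a ∈ A, g • a ∈ A := by
        rintro g hg a ⟨g', hg', rfl⟩
        exact ⟨g * g', mul_mem hg hg', mul_smul _ _ _⟩
      have hAW : A ⊆ W := by
        rintro a ⟨g, hg, rfl⟩
        exact hS.smul_mem g hg x hS.mem
      obtain ⟨o, ho⟩ := hS.reduced_smul hG hR hA hh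
        (.nil ⟨1, one_mem _, one_smul _ _⟩ : Reduced R (S.nbhd K W \ W) A none x)
      generalize h • x = y at ho
      induction ho with
      | nil hw =>
        obtain ⟨g, hg, rfl⟩ := hw
        exact ih g hg
      | @cons o y v s hv hs h1 ho h' ih' =>
        obtain ⟨hne, hd⟩ := h'.le_of_cons hC hR hL (projBounded_windmill hC hG hR hL x i) hAW
          hv hs h1 ho
        refine step _ v s⁻¹ (inv_mem hs) (fun e => hv.2 (e ▸ hS.mem)) hne (hd x hS.mem) ?_
        rwa [inv_smul_smul]
  intro h hh
  obtain ⟨i, hi⟩ := exists_mem_windmillGroup (K := K) hC hG hR x hh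
  exact key i h hi

end ProjectionSystem

/-! ## Edge paths -/

namespace EdgeGraph

variable {X Z : EdgeGraph.{u}}

theorem Follows.append : ∀ {l l' : List X.E} {a b c : X.V}, X.Follows a l b → X.Follows b l' c →
    X.Follows a (l ++ l') c
  | [], _, _, _, _, h, h' => by
    cases h
    exact h'
  | _ :: _, _, _, _, _, h, h' => ⟨h.1, h.2.append h'⟩

theorem Follows.split : ∀ {l l' : List X.E} {a c : X.V}, X.Follows a (l ++ l') c →
    ∃ b, X.Follows a l b ∧ X.Follows b l' c
  | [], _, a, _, h => ⟨a, rfl, h⟩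
  | _ :: _, _, _, _, h => by
    obtain ⟨b, h1, h2⟩ := Follows.split h.2
    exact ⟨b, ⟨h.1, h1⟩, h2⟩

theorem Follows.unique : ∀ {l : List X.E} {a b c : X.V}, X.Follows a l b → X.Follows a l c → b = c
  | [], _, _, _, h, h' => h.symm.trans h'
  | _ :: _, _, _, _, h, h' => Follows.unique h.2 h'.2

/-- A shorter competitor would map to a shorter competitor, since morphisms preserve the number of
edges. -/
theorem EdgePath.isGeodesic_of_map {f : Hom X Z} {α : X.EdgePath} (h : (α.map f).IsGeodesic) :
    α.IsGeodesic := by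
  intro β hs hf
  have := h (β.map f) (congrArg f.onV hs) (congrArg f.onV hf)
  simpa [EdgePath.length, EdgePath.map] using this

end EdgeGraph

/-! ### Edge paths and geodesics of the complex -/

namespace ProjectionSystem

variable {Y : Type u} {S : ProjectionSystem Y} {K C L : ℝ}

/-- Recording how the edge list splits at each visited vertex allows a path to be cut there and its
second half rotated. -/
theorem exists_walk_of_follows : ∀ {l : List (S.complex K).E} {x y : Y},
    (S.complex K).Follows x l y → ∃ w : (S.graph K).Walk x y, w.length = l.length ∧
      ∀ v ∈ w.support, ∃ l₁ l₂, l = l₁ ++ l₂ ∧ (S.complex K).Follows x l₁ v ∧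
        (S.complex K).Follows v l₂ y
  | [], x, y, h => by
    obtain rfl : x = y := h
    refine ⟨.nil, rfl, fun v hv => ?_⟩
    obtain rfl : v = x := by simpa using hv
    exact ⟨[], [], rfl, rfl, rfl⟩
  | e :: l, x, y, h => by
    obtain ⟨w, hw, hw'⟩ := exists_walk_of_follows (x := e.snd) h.2
    obtain rfl : e.fst = x := h.1
    refine ⟨.cons e.adj w, congrArg (· + 1) hw, fun v hv => ?_⟩
    rcases List.mem_cons.1 hv with rfl | hv
    · exact ⟨[], e :: l, rfl, rfl, h⟩
    · obtain ⟨l₁, l₂, rfl, h1, h2⟩ := hw' v hv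
      exact ⟨e :: l₁, l₂, rfl, ⟨rfl, h1⟩, h2⟩

theorem follows_of_walk {x y : Y} (w : (S.graph K).Walk x y) :
    ∃ l, (S.complex K).Follows x l y ∧ l.length = w.length := by
  induction w with
  | nil => exact ⟨[], rfl, rfl⟩
  | cons h _ ih =>
    obtain ⟨l, hl, hl'⟩ := ih
    exact ⟨⟨(_, _), h⟩ :: l, ⟨rfl, hl⟩, congrArg (· + 1) hl'⟩

theorem dist_le_of_follows {l : List (S.complex K).E} {x y : Y}
    (h : (S.complex K).Follows x l y) : (S.graph K).dist x y ≤ l.length := by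
  obtain ⟨w, hw, -⟩ := exists_walk_of_follows h
  exact hw ▸ SimpleGraph.dist_le w

namespace HasBounds

variable (hC : S.HasBounds K C)

include hC

theorem length_eq_dist {α : (S.complex K).EdgePath} (h : α.IsGeodesic) :
    α.edges.length = (S.graph K).dist α.start α.finish := by
  refine le_antisymm ?_ (dist_le_of_follows α.follows)
  obtain ⟨w, hw⟩ := (hC.preconnected α.start α.finish).exists_walk_length_eq_dist
  obtain ⟨l, hl, hl'⟩ := follows_of_walk w
  rw [← hw, ← hl']
  exact h ⟨_, _, l, hl⟩ rfl rfl

/-- A geodesic whose endpoints have large projection to `v` passes through `v`. -/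
theorem exists_split {α : (S.complex K).EdgePath} (h : α.IsGeodesic) {v : Y} (hs : α.start ≠ v)
    (hf : α.finish ≠ v) (hv : C < S.d v α.start α.finish) :
    ∃ l₁ l₂, α.edges = l₁ ++ l₂ ∧ (S.complex K).Follows α.start l₁ v ∧
      (S.complex K).Follows v l₂ α.finish := by
  obtain ⟨w, hw, hw'⟩ := exists_walk_of_follows α.follows
  refine hw' v ?_
  by_contra hvw
  exact absurd (hC.geodesic _ _ _ hs hf w (hw.trans (hC.length_eq_dist h)) hvw) (not_le.2 hv)

theorem between_of_split {α : (S.complex K).EdgePath} (h : α.IsGeodesic)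
    {l₁ l₂ : List (S.complex K).E} {a : Y} (hl : α.edges = l₁ ++ l₂)
    (h₁ : (S.complex K).Follows α.start l₁ a) (h₂ : (S.complex K).Follows a l₂ α.finish) :
    S.Between K α.start a α.finish := by
  have e := hC.length_eq_dist h
  rw [hl, List.length_append] at e
  have h3 := dist_le_of_follows h₁
  have h4 := dist_le_of_follows h₂
  have h5 := hC.dist_triangle α.start a α.finish
  unfold Between
  omega

/-- If both projections were large, a geodesic from `x` to `y` through `a` would meet `v` both
before and after `a`. -/
theorem le_or_le_of_between {x a y v : Y} (h : S.Between K x a y) (hav : a ≠ v) :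
    S.d v x a ≤ C ∨ S.d v a y ≤ C := by
  by_contra hcon
  push Not at hcon
  have h1 : S.Between K x v a := by
    by_contra h'
    exact absurd (hC.le_of_not_between h') (not_le.2 hcon.1)
  have h2 : S.Between K a v y := by
    by_contra h'
    exact absurd (hC.le_of_not_between h') (not_le.2 hcon.2)
  refine hav (hC.eq_of_dist_eq_zero ?_)
  unfold Between at *
  have h3 := hC.dist_triangle x v y
  have h4 := (S.graph K).dist_comm (u := a) (v := v)
  omega

end HasBounds

/-! ### Lifts of paths -/

section Lifts

variable {G : Type v} [Group G] [MulAction G Y] {R : Y → Subgroup G}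

theorem exists_smul_eq {H : Subgroup G} {x y : Y}
    (h : (Quotient.mk (MulAction.orbitRel H Y) x) = Quotient.mk (MulAction.orbitRel H Y) y) :
    ∃ g ∈ H, g • x = y := by
  obtain ⟨g, hg⟩ := Quotient.exact h.symm
  exact ⟨g, g.2, hg⟩

theorem quotientMap_translate (hG : S.IsInvariant G) {H : Subgroup G} {g : G} (hg : g ∈ H)
    (e : (S.complex K).E) :
    (S.quotientMap K H).onE ((hG.translate K g).onE e) = (S.quotientMap K H).onE e :=
  (Quotient.sound ⟨g, hg, rfl, rfl⟩ : Quotient.mk (S.edgeSetoid K H) e = _).symm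

theorem map_quotientMap_translate (hG : S.IsInvariant G) {H : Subgroup G} {g : G} (hg : g ∈ H)
    (l : List (S.complex K).E) :
    (l.map (hG.translate K g).onE).map (S.quotientMap K H).onE =
      l.map (S.quotientMap K H).onE := by
  rw [List.map_map]
  exact List.map_congr_left fun e _ => quotientMap_translate hG hg e

theorem quotientMap_onV_smul {H : Subgroup G} {g : G} (hg : g ∈ H) (x : Y) :
    (S.quotientMap K H).onV ((g • x : Y)) = (S.quotientMap K H).onV x :=
  (orbit_mk_eq H hg rfl).symm

theorem translate_isLift (hG : S.IsInvariant G) {H : Subgroup G} {g : G} (hg : g ∈ H)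
    {α : (S.complex K).EdgePath} {αbar : (S.quotientComplex K H).EdgePath}
    (h : α.map (S.quotientMap K H) = αbar) :
    (α.map (hG.translate K g)).map (S.quotientMap K H) = αbar := by
  rw [← h]
  exact EdgeGraph.EdgePath.ext (quotientMap_onV_smul hg _) (quotientMap_onV_smul hg _)
    (map_quotientMap_translate hG hg _)

theorem translate_translate (hG : S.IsInvariant G) (g h : G) (α : (S.complex K).EdgePath) :
    (α.map (hG.translate K g)).map (hG.translate K h) = α.map (hG.translate K (h * g)) := by
  refine EdgeGraph.EdgePath.ext (mul_smul (β := Y) h g α.start).symm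
    (mul_smul (β := Y) h g α.finish).symm ?_
  simp only [EdgeGraph.EdgePath.map, List.map_map]
  refine List.map_congr_left fun e _ => ?_
  refine SimpleGraph.Dart.ext _ _ (Prod.ext ?_ ?_)
  · exact (mul_smul h g e.fst).symm
  · exact (mul_smul h g e.snd).symm

theorem translate_one (hG : S.IsInvariant G) (α : (S.complex K).EdgePath) :
    α.map (hG.translate K (1 : G)) = α := by
  refine EdgeGraph.EdgePath.ext (one_smul (α := Y) G α.start) (one_smul (α := Y) G α.finish) ?_
  simp only [EdgeGraph.EdgePath.map]
  conv_rhs => rw [← List.map_id α.edges]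
  refine List.map_congr_left fun e _ => ?_
  refine SimpleGraph.Dart.ext _ _ (Prod.ext ?_ ?_)
  · exact one_smul G e.fst
  · exact one_smul G e.snd

theorem exists_follows_lift (hG : S.IsInvariant G) {H : Subgroup G} :
    ∀ {l : List (S.quotientComplex K H).E} {a b : (S.quotientComplex K H).V},
      (S.quotientComplex K H).Follows a l b → ∀ x : Y, (S.quotientMap K H).onV x = a →
      ∃ (l' : List (S.complex K).E) (y : Y), (S.complex K).Follows x l' y ∧
        l'.map (S.quotientMap K H).onE = l ∧ (S.quotientMap K H).onV y = b
  | [], _, _, h, x, hx => ⟨[], x, rfl, rfl, hx.trans h⟩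
  | e :: l, _, _, h, x, hx => by
    induction e using Quotient.inductionOn with
    | _ e =>
    obtain ⟨g, hg, hgx⟩ := exists_smul_eq (h.1.trans hx.symm)
    obtain ⟨l', y, h1, h2, h3⟩ := exists_follows_lift hG h.2 (g • e.snd)
      (quotientMap_onV_smul hg e.snd)
    refine ⟨(hG.translate K g).onE e :: l', y, ⟨hgx, h1⟩, ?_, h3⟩
    exact congrArg₂ List.cons (quotientMap_translate hG hg _) h2

theorem exists_lift (hG : S.IsInvariant G) {H : Subgroup G}
    (αbar : (S.quotientComplex K H).EdgePath) :
    ∃ α : (S.complex K).EdgePath, α.map (S.quotientMap K H) = αbar := by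
  obtain ⟨x, hx⟩ := Quotient.exists_rep αbar.start
  obtain ⟨l, y, h1, h2, h3⟩ := exists_follows_lift hG αbar.follows x hx
  exact ⟨⟨x, y, l, h1⟩, EdgeGraph.EdgePath.ext hx h3 h2⟩

/-- Rotating the end of a lift of a geodesic about a vertex to which it has large projection
gives another lift. -/
theorem exists_bend (hC : S.HasBounds K C) (hG : S.IsInvariant G)
    (hR : S.IsSpinningFamily L R) {H : Subgroup G} {αbar : (S.quotientComplex K H).EdgePath}
    (hbar : αbar.IsGeodesic) {α : (S.complex K).EdgePath} (h : α.map (S.quotientMap K H) = αbar)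
    {v : Y} (hv : α.start ≠ v → α.finish ≠ v → C < S.d v α.start α.finish) {s : G}
    (hs : s ∈ R v) (hsH : s ∈ H) :
    ∃ β : (S.complex K).EdgePath, β.map (S.quotientMap K H) = αbar ∧ β.start = α.start ∧
      β.finish = (hG.translate K s).onV α.finish := by
  have e : (hG.translate K s).onV v = v := hR.smul_self hs
  -- At an endpoint equal to `v` the hypothesis `hv` is vacuous: rotate the whole path if it starts
  -- at `v`, and nothing if it ends there.
  by_cases h1 : α.start = v
  · refine ⟨_, translate_isLift hG hsH h, ?_, rfl⟩
    exact (congrArg (hG.translate K s).onV h1).trans (e.trans h1.symm)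
  by_cases h2 : α.finish = v
  · refine ⟨α, h, rfl, ?_⟩
    rw [h2]
    exact (hR.smul_self hs).symm
  have hα : α.IsGeodesic := EdgeGraph.EdgePath.isGeodesic_of_map (h ▸ hbar)
  obtain ⟨l₁, l₂, hl, hl₁, hl₂⟩ := hC.exists_split hα h1 h2 (hv h1 h2)
  have hl₂' := hl₂.map (hG.translate K s)
  rw [e] at hl₂'
  refine ⟨⟨_, _, _, hl₁.append hl₂'⟩, ?_, rfl, rfl⟩
  rw [← h]
  refine EdgeGraph.EdgePath.ext rfl (quotientMap_onV_smul hsH _) ?_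
  simp only [EdgeGraph.EdgePath.map]
  rw [hl, List.map_append, List.map_append, map_quotientMap_translate hG hsH]

end Lifts

end ProjectionSystem

namespace ProjectionSystem

variable {Y : Type u} {S : ProjectionSystem Y} {K B C L : ℝ}
variable {G : Type v} [Group G] [MulAction G Y] {R : Y → Subgroup G}

/-! ### Uniqueness of lifts with bounded projections -/

theorem eq_of_projections_lt (hC : S.HasBounds K C) (hG : S.IsInvariant G)
    (hR : S.IsSpinningFamily L R) (hL : 40 * C < L) {h : G} (hh : h ∈ familySpan R) {a b : Y}
    (hab : h • a = b) (hd : ∀ v, a ≠ v → b ≠ v → S.d v a b < L - 15 * C) : a = b := by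
  subst hab
  refine shortening_induction hC hG hR hL a
    (P := fun y => (∀ v, a ≠ v → y ≠ v → S.d v a y < L - 15 * C) → a = y) (fun _ => rfl) ?_ h hh hd
  intro y v s _ hav hyv hle _ hd
  exact absurd (hd v hav hyv) (not_lt.2 hle)

/-- From any `v` other than `x` and `y`, each of `a` and `b` looks within `C` of one of the
endpoints, so `a` and `b` are at projection distance at most `B + 2 * C`. If `v` is itself an
endpoint, both look within `C` of the other one. This is too little for distinct points of one
`H`-orbit. -/
theorem eq_of_between (hC : S.HasBounds K C) (hG : S.IsInvariant G)
    (hR : S.IsSpinningFamily L R) (hL : 40 * C + 4 * B < L) (hB : 0 ≤ B) {x y a b : Y}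
    (hxy : ∀ v, v ≠ x → v ≠ y → S.d v x y ≤ B) (ha : S.Between K x a y)
    (hb : S.Between K x b y) {h : G} (hh : h ∈ familySpan R) (hab : h • a = b) : a = b := by
  have h0 := hC.nonneg
  refine eq_of_projections_lt hC hG hR (by linarith) hh hab fun v hav hbv => ?_
  by_cases hvx : x = v
  · subst hvx
    have key : ∀ {c}, S.Between K x c y → c ≠ x → S.d x c y ≤ C ∧ y ≠ x := by
      intro c hc hcx
      have hne : (S.graph K).dist x c ≠ 0 := fun e => hcx (hC.eq_of_dist_eq_zero e).symm
      have e := (S.graph K).dist_comm (u := x) (v := c)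
      refine ⟨hC.le_of_not_between fun h' => ?_, ?_⟩
      · unfold Between at *
        omega
      · rintro rfl
        unfold Between at hc
        rw [SimpleGraph.dist_self] at hc
        omega
    obtain ⟨h1, hy⟩ := key ha hav
    obtain ⟨h2, -⟩ := key hb hbv
    have h3 := S.triangle x a y b hav hy hbv
    rw [S.symm x y b hy hbv] at h3
    linarith
  by_cases hvy : y = v
  · subst hvy
    have key : ∀ {c}, S.Between K x c y → c ≠ y → S.d y x c ≤ C := by
      intro c hc hcy
      exact hC.le_of_between hc hcy
    have h1 := key ha hav
    have h2 := key hb hbv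
    have h3 := S.triangle y a x b hav hvx hbv
    rw [S.symm y a x hav hvx] at h3
    linarith
  have hB' := hxy v (Ne.symm hvx) (Ne.symm hvy)
  have h1 := S.symm v x a hvx hav
  have h2 := S.symm v b y hbv hvy
  have h3 := S.symm v y x hvy hvx
  rcases hC.le_or_le_of_between ha hav with ha' | ha' <;>
    rcases hC.le_or_le_of_between hb hbv with hb' | hb'
  · linarith [S.triangle v a x b hav hvx hbv]
  · linarith [S.triangle v a x b hav hvx hbv, S.triangle v x y b hvx hvy hbv]
  · linarith [S.triangle v a y b hav hvy hbv, S.triangle v y x b hvy hvx hbv]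
  · linarith [S.triangle v a y b hav hvy hbv]

/-- After a common initial segment `l₁`, the next vertices of the two paths are in one `H`-orbit and
both lie between the common endpoints, so `eq_of_between` identifies them. -/
theorem edges_eq_of_endpoints_eq (hC : S.HasBounds K C) (hG : S.IsInvariant G)
    (hR : S.IsSpinningFamily L R) (hL : 40 * C + 4 * B < L) (hB : 0 ≤ B)
    {β β' : (S.complex K).EdgePath} (hβ : β.IsGeodesic) (hβ' : β'.IsGeodesic)
    (hmap : β.map (S.quotientMap K (familySpan R)) = β'.map (S.quotientMap K (familySpan R)))
    (hs : β.start = β'.start) (hf : β.finish = β'.finish) (hbd : S.ProjectionsBoundedBy β B) :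
    β = β' := by
  have hedges : β.edges.map (S.quotientMap K (familySpan R)).onE =
      β'.edges.map (S.quotientMap K (familySpan R)).onE := congrArg (·.edges) hmap
  have key : ∀ l₂ l₂' l₁ : List (S.complex K).E, β.edges = l₁ ++ l₂ → β'.edges = l₁ ++ l₂' →
      l₂.map (S.quotientMap K (familySpan R)).onE =
        l₂'.map (S.quotientMap K (familySpan R)).onE → l₂ = l₂' := by
    intro l₂
    induction l₂ with
    | nil =>
      intro l₂' l₁ _ _ h
      exact (List.map_eq_nil_iff.1 h.symm).symm
    | cons e l₂ ih =>
      intro l₂' l₁ hl hl' h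
      cases l₂' with
      | nil => simp at h
      | cons e' l₂' =>
        rw [List.map_cons, List.map_cons, List.cons.injEq] at h
        have f := β.follows
        have f' := β'.follows
        rw [hl] at f
        rw [hl', ← hs, ← hf] at f'
        obtain ⟨a, f1, f2⟩ := f.split
        obtain ⟨a', f1', f2'⟩ := f'.split
        obtain rfl := f1.unique f1'
        have hfst : (S.complex K).src e = (S.complex K).src e' := f2.1.trans f2'.1.symm
        have hsnd : (S.complex K).tgt e = (S.complex K).tgt e' := by
          have g1 : (S.complex K).Follows β.start (l₁ ++ [e]) ((S.complex K).tgt e) :=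
            f1.append ⟨f2.1, rfl⟩
          have g1' : (S.complex K).Follows β'.start (l₁ ++ [e']) ((S.complex K).tgt e') :=
            hs ▸ f1'.append ⟨f2'.1, rfl⟩
          have b1 := hC.between_of_split hβ (l₁ := l₁ ++ [e]) (by simpa using hl) g1 f2.2
          have b1' := hC.between_of_split hβ' (l₁ := l₁ ++ [e']) (by simpa using hl') g1'
            (hf ▸ f2'.2)
          rw [← hs, ← hf] at b1'
          obtain ⟨g, hg, -, hg2⟩ := Quotient.exact h.1
          exact eq_of_between hC hG hR hL hB hbd b1 b1' hg hg2
        obtain rfl : e = e' := SimpleGraph.Dart.ext _ _ (Prod.ext hfst hsnd)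
        rw [ih l₂' (l₁ ++ [e]) (by simpa using hl) (by simpa using hl') h.2]
  exact EdgeGraph.EdgePath.ext hs hf (key _ _ [] rfl rfl hedges)

theorem ProjectionsBoundedBy.translate (hG : S.IsInvariant G) {β : (S.complex K).EdgePath}
    (h : S.ProjectionsBoundedBy β B) (g : G) :
    S.ProjectionsBoundedBy (β.map (hG.translate K g)) B := by
  intro v hs hf
  obtain ⟨w, rfl⟩ := MulAction.surjective g v
  have hs' : w ≠ β.start := fun e => hs (e ▸ rfl)
  have hf' : w ≠ β.finish := fun e => hf (e ▸ rfl)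
  exact (hG g w _ _ hs'.symm hf'.symm).trans_le (h w hs' hf')

/-- Lifts of a geodesic with bounded projections are translates of each other. -/
theorem exists_translate_eq (hC : S.HasBounds K C) (hG : S.IsInvariant G)
    (hR : S.IsSpinningFamily L R) (hL : 40 * C + 4 * B < L) (hB : 0 ≤ B)
    {αbar : (S.quotientComplex K (familySpan R)).EdgePath} (hbar : αbar.IsGeodesic)
    {β β' : (S.complex K).EdgePath} (hβ : β.map (S.quotientMap K (familySpan R)) = αbar)
    (hβ' : β'.map (S.quotientMap K (familySpan R)) = αbar) (hbd : S.ProjectionsBoundedBy β B)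
    (hbd' : S.ProjectionsBoundedBy β' B) :
    ∃ h ∈ familySpan R, β = β'.map (hG.translate K h) := by
  have h0 := hC.nonneg
  have key : ∀ h ∈ familySpan R, ∀ β' : (S.complex K).EdgePath,
      β'.map (S.quotientMap K (familySpan R)) = αbar → S.ProjectionsBoundedBy β' B →
      β'.finish = β.finish → β'.start = (hG.translate K h).onV β.start →
      ∃ g ∈ familySpan R, β = β'.map (hG.translate K g) := by
    intro h hh
    refine shortening_induction hC hG hR (by linarith) β.start
      (P := fun y => ∀ β' : (S.complex K).EdgePath,
      β'.map (S.quotientMap K (familySpan R)) = αbar → S.ProjectionsBoundedBy β' B →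
      β'.finish = β.finish → β'.start = y →
      ∃ g ∈ familySpan R, β = β'.map (hG.translate K g)) ?_ ?_ h hh
    · intro β' hβ' _ hf hs
      refine ⟨1, one_mem _, ?_⟩
      rw [translate_one]
      exact edges_eq_of_endpoints_eq hC hG hR hL hB
        (EdgeGraph.EdgePath.isGeodesic_of_map (hβ ▸ hbar))
        (EdgeGraph.EdgePath.isGeodesic_of_map (hβ' ▸ hbar)) (hβ.trans hβ'.symm) hs.symm hf.symm hbd
    · rintro y v s hs hxv hyv hd ih β' hβ' hbd' hf rfl
      have hsH : s ∈ familySpan R := le_iSup R v hs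
      -- Rotation about `v` preserves the common finish only if that is `v`. Otherwise both paths
      -- project within `B` at `v`, so their starts are within `2 * B`, contrary to the large
      -- projection.
      by_cases hv : β.finish = v
      · have e : (hG.translate K s).onV v = v := hR.smul_self hs
        obtain ⟨g, hg, e⟩ := ih (β'.map (hG.translate K s)) (translate_isLift hG hsH hβ')
          (hbd'.translate hG s)
          ((congrArg (hG.translate K s).onV (hf.trans hv)).trans (e.trans hv.symm)) rfl
        exact ⟨g * s, mul_mem hg hsH, by rw [e, translate_translate]⟩
      · have h1 := hbd v hxv.symm (Ne.symm hv)
        have h2 := hbd' v hyv.symm (by rw [hf]; exact Ne.symm hv)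
        rw [hf, S.symm v _ _ hyv hv] at h2
        have h3 := S.triangle v _ _ _ hxv hv hyv
        linarith
  have e := hβ.trans hβ'.symm
  -- Translate `β'` so that the two paths end at the same vertex; then only their starts differ, by
  -- an element of `H`.
  obtain ⟨g, hg, hgf⟩ := exists_smul_eq (congrArg (·.finish) e.symm)
  obtain ⟨g', hg', hgs⟩ := exists_smul_eq (congrArg (·.start)
    (hβ.trans (translate_isLift hG hg hβ').symm))
  obtain ⟨k, hk, e⟩ := key g' hg' _ (translate_isLift hG hg hβ') (hbd'.translate hG g) hgf hgs.symm
  exact ⟨k * g, mul_mem hk hg, by rw [e, translate_translate]⟩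

/-! ### Closing up quadrilaterals -/

/-- A set of lifts of `αbar`, closed under translation, and under rotating the end about vertices
to which the projection is larger than `B`. -/
structure IsFlexible (hG : S.IsInvariant G) (R : Y → Subgroup G) (B : ℝ)
    (αbar : (S.quotientComplex K (familySpan R)).EdgePath) (A : Set (S.complex K).EdgePath) :
    Prop where
  nonempty : A.Nonempty
  isLift : ∀ α ∈ A, α.map (S.quotientMap K (familySpan R)) = αbar
  translate : ∀ α ∈ A, ∀ g ∈ familySpan R, α.map (hG.translate K g) ∈ A
  bend : ∀ α ∈ A, ∀ v, (α.start ≠ v → α.finish ≠ v → B < S.d v α.start α.finish) → ∀ s ∈ R v,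
    ∃ β ∈ A, β.start = α.start ∧ β.finish = (hG.translate K s).onV α.finish

theorem isFlexible_lifts (hC : S.HasBounds K C) (hG : S.IsInvariant G)
    (hR : S.IsSpinningFamily L R) (hB : C ≤ B)
    {αbar : (S.quotientComplex K (familySpan R)).EdgePath} (hbar : αbar.IsGeodesic) :
    IsFlexible hG R B αbar {α | α.map (S.quotientMap K (familySpan R)) = αbar} where
  nonempty := exists_lift hG αbar
  isLift _ h := h
  translate _ h _ hg := translate_isLift hG hg h
  bend _ h _ hv _ hs := exists_bend hC hG hR hbar h (fun h1 h2 => hB.trans_lt (hv h1 h2)) hs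
    (le_iSup R _ hs)

/-- A translate never has projection larger than `B` at a vertex other than its endpoints, and
rotation about an endpoint is achieved by translating or doing nothing. No genuine bending takes
place. -/
theorem isFlexible_translates (hG : S.IsInvariant G)
    (hR : S.IsSpinningFamily L R) {αbar : (S.quotientComplex K (familySpan R)).EdgePath}
    {β : (S.complex K).EdgePath} (hβ : β.map (S.quotientMap K (familySpan R)) = αbar)
    (hbd : S.ProjectionsBoundedBy β B) :
    IsFlexible hG R B αbar {α | ∃ h ∈ familySpan R, α = β.map (hG.translate K h)} := by
  have htr : ∀ α, (∃ h ∈ familySpan R, α = β.map (hG.translate K h)) → ∀ g ∈ familySpan R,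
      ∃ h ∈ familySpan R, α.map (hG.translate K g) = β.map (hG.translate K h) := by
    rintro _ ⟨h, hh, rfl⟩ g hg
    exact ⟨g * h, mul_mem hg hh, translate_translate hG h g β⟩
  refine ⟨⟨β, 1, one_mem _, (translate_one hG β).symm⟩, ?_, htr, ?_⟩
  · rintro _ ⟨h, hh, rfl⟩
    exact translate_isLift hG hh hβ
  · intro α hα v hv s hs
    have e : (hG.translate K s).onV v = v := hR.smul_self hs
    by_cases h1 : α.start = v
    · exact ⟨_, htr α hα s (le_iSup R v hs),
        (congrArg (hG.translate K s).onV h1).trans (e.trans h1.symm), rfl⟩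
    by_cases h2 : α.finish = v
    · exact ⟨α, hα, rfl, h2.trans (e.symm.trans (congrArg (hG.translate K s).onV h2.symm))⟩
    obtain ⟨h, hh, rfl⟩ := hα
    exact absurd (hbd.translate hG h v (Ne.symm h1) (Ne.symm h2)) (not_le.2 (hv h1 h2))

/-- Chains of four segments ending in the orbit of their starting point can be closed up, if the
segments can be rotated about vertices to which they have large projection. -/
theorem exists_closed_chain (hC : S.HasBounds K C) (hG : S.IsInvariant G)
    (hR : S.IsSpinningFamily L R) (hL : 40 * C + 4 * B < L) (hB : 0 ≤ B) (rel : Fin 4 → Y → Y → Prop)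
    (htr : ∀ k a b, ∀ h ∈ familySpan R, rel k a b → rel k (h • a) (h • b))
    (hbend : ∀ k a b v, ∀ s ∈ R v, (a ≠ v → b ≠ v → B + C < S.d v a b) → rel k a b →
      rel k a (s • b))
    (x : Y) : ∀ h ∈ familySpan R, ∀ a b c, rel 0 x a → rel 1 a b → rel 2 b c → rel 3 c (h • x) →
      ∃ a b c, rel 0 x a ∧ rel 1 a b ∧ rel 2 b c ∧ rel 3 c x := by
  have h0 := hC.nonneg
  refine shortening_induction hC hG hR (by linarith) x (P := fun y =>
    ∀ a b c, rel 0 x a → rel 1 a b → rel 2 b c → rel 3 c y →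
      ∃ a b c, rel 0 x a ∧ rel 1 a b ∧ rel 2 b c ∧ rel 3 c x)
    (fun a b c h0 h1 h2 h3 => ⟨a, b, c, h0, h1, h2, h3⟩) ?_
  intro y v s hs hxv hyv hd ih a b c r0 r1 r2 r3
  have tr := fun k a b => htr k a b s (le_iSup R v hs)
  -- Written as an implication, the condition also holds when the segment has an endpoint at `v`.
  -- The segment that satisfies it is bent, the later ones are translated by `s`, and the chain then
  -- ends at `s • y`.
  by_cases c0 : x ≠ v → a ≠ v → B + C < S.d v x a
  · exact ih _ _ _ (hbend 0 x a v s hs c0 r0) (tr 1 _ _ r1) (tr 2 _ _ r2) (tr 3 _ _ r3)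
  by_cases c1 : a ≠ v → b ≠ v → B + C < S.d v a b
  · exact ih _ _ _ r0 (hbend 1 a b v s hs c1 r1) (tr 2 _ _ r2) (tr 3 _ _ r3)
  by_cases c2 : b ≠ v → c ≠ v → B + C < S.d v b c
  · exact ih _ _ _ r0 r1 (hbend 2 b c v s hs c2 r2) (tr 3 _ _ r3)
  by_cases c3 : c ≠ v → y ≠ v → B + C < S.d v c y
  · exact ih _ _ _ r0 r1 r2 (hbend 3 c y v s hs c3 r3)
  -- If no segment can be bent, the four projections add up to at most `4 * (B + C)`, which is less
  -- than `L - 15 * C`.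
  push Not at c0 c1 c2 c3
  obtain ⟨-, hav, d0⟩ := c0
  obtain ⟨-, hbv, d1⟩ := c1
  obtain ⟨-, hcv, d2⟩ := c2
  obtain ⟨-, -, d3⟩ := c3
  linarith [S.triangle v x a y hxv hav hyv, S.triangle v a b y hav hbv hyv,
    S.triangle v b c y hbv hcv hyv]

theorem exists_quadrilateral (hC : S.HasBounds K C) (hG : S.IsInvariant G)
    (hR : S.IsSpinningFamily L R) (hL : 40 * C + 4 * B < L) (hB : 0 ≤ B)
    {αbar : Fin 4 → (S.quotientComplex K (familySpan R)).EdgePath}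
    (hbar : ∀ k, (αbar k).finish = (αbar (k + 1)).start)
    {A : Fin 4 → Set (S.complex K).EdgePath}
    (hA : ∀ k, IsFlexible hG R (B + C) (αbar k) (A k)) :
    ∃ α : Fin 4 → (S.complex K).EdgePath, (∀ k, α k ∈ A k) ∧
      ∀ k, (α k).finish = (α (k + 1)).start := by
  let rel : Fin 4 → Y → Y → Prop := fun k a b => ∃ α ∈ A k, α.start = a ∧ α.finish = b
  have next : ∀ k, ∀ α ∈ A k, ∃ α' ∈ A (k + 1), α'.start = α.finish := by
    intro k α hα
    obtain ⟨β, hβ⟩ := (hA (k + 1)).nonempty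
    have e1 : (S.quotientMap K (familySpan R)).onV β.start = (αbar (k + 1)).start :=
      congrArg (·.start) ((hA (k + 1)).isLift β hβ)
    have e2 : (S.quotientMap K (familySpan R)).onV α.finish = (αbar k).finish :=
      congrArg (·.finish) ((hA k).isLift α hα)
    obtain ⟨g, hg, e⟩ := exists_smul_eq (e1.trans ((hbar k).symm.trans e2.symm))
    exact ⟨_, (hA (k + 1)).translate β hβ g hg, e⟩
  obtain ⟨α₀, h₀⟩ := (hA 0).nonempty
  obtain ⟨α₁, h₁, e₁⟩ := next 0 α₀ h₀
  obtain ⟨α₂, h₂, e₂⟩ := next 1 α₁ h₁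
  obtain ⟨α₃, h₃, e₃⟩ := next 2 α₂ h₂
  have f1 : (S.quotientMap K (familySpan R)).onV α₀.start = (αbar 0).start :=
    congrArg (·.start) ((hA 0).isLift _ h₀)
  have f2 : (S.quotientMap K (familySpan R)).onV α₃.finish = (αbar 3).finish :=
    congrArg (·.finish) ((hA 3).isLift _ h₃)
  obtain ⟨g, hg, e⟩ := exists_smul_eq (f1.trans ((hbar 3).symm.trans f2.symm))
  have htr : ∀ k a b, ∀ h ∈ familySpan R, rel k a b → rel k (h • a) (h • b) := by
    rintro k _ _ h hh ⟨α, hα, rfl, rfl⟩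
    exact ⟨_, (hA k).translate α hα h hh, rfl, rfl⟩
  have hbend : ∀ k a b v, ∀ s ∈ R v, (a ≠ v → b ≠ v → B + C < S.d v a b) → rel k a b →
      rel k a (s • b) := by
    rintro k _ _ v s hs hv ⟨α, hα, rfl, rfl⟩
    exact (hA k).bend α hα v hv s hs
  obtain ⟨a, b, c, ⟨γ₀, m₀, s₀, t₀⟩, ⟨γ₁, m₁, s₁, t₁⟩, ⟨γ₂, m₂, s₂, t₂⟩, ⟨γ₃, m₃, s₃, t₃⟩⟩ :=
    exists_closed_chain hC hG hR hL hB rel htr hbend α₀.start g hg α₀.finish α₁.finish α₂.finish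
      ⟨α₀, h₀, rfl, rfl⟩ ⟨α₁, h₁, e₁, rfl⟩ ⟨α₂, h₂, e₂, rfl⟩ ⟨α₃, h₃, e₃, e.symm⟩
  · refine ⟨![γ₀, γ₁, γ₂, γ₃], fun k => ?_, fun k => ?_⟩
    · fin_cases k
      exacts [m₀, m₁, m₂, m₃]
    · fin_cases k
      exacts [t₀.trans s₁.symm, t₁.trans s₂.symm, t₂.trans s₃.symm, t₃.trans s₀.symm]

end ProjectionSystem

/-! ### Assembling the quadrilateral -/

theorem proposition4p3 {Y : Type u} (S : ProjectionSystem Y) (K : ℝ)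
    (hP : S.IsProjectionComplex K) (B : ℝ) (hB : 0 ≤ B) :
    ∃ Llift : ℝ, ∀ (G : Type v) [Group G] [MulAction G Y] (hG : S.IsInvariant G)
      (L : ℝ), Llift ≤ L → ∀ R : Y → Subgroup G, S.IsSpinningFamily L R →
      ∀ αbar : Fin 4 → (S.quotientComplex K (familySpan R)).EdgePath,
        EdgeGraph.IsGeodesicQuadrilateral αbar →
        ∃ α : Fin 4 → (S.complex K).EdgePath,
          EdgeGraph.IsGeodesicQuadrilateral α ∧
          (∀ k, (α k).map (S.quotientMap K (familySpan R)) = αbar k) ∧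
          ∀ β₀ β₂ : (S.complex K).EdgePath,
            β₀.map (S.quotientMap K (familySpan R)) = αbar 0 →
            β₂.map (S.quotientMap K (familySpan R)) = αbar 2 →
            S.ProjectionsBoundedBy β₀ B → S.ProjectionsBoundedBy β₂ B →
            (∃ h ∈ familySpan R, α 0 = β₀.map (hG.translate K h)) ∧
            (∃ h ∈ familySpan R, α 2 = β₂.map (hG.translate K h)) := by
  obtain ⟨C, hC⟩ := hP.exists_hasBounds
  -- Ping-pong needs `L` above `30 * C`, and closing a four-sided chain needs it above `19 * C + 4 *
  -- B`; this value covers both, and the final `1` makes the inequality strict.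
  refine ⟨40 * C + 4 * B + 1, ?_⟩
  intro G _ _ hG L hL' R hR αbar hQ
  have hL : 40 * C + 4 * B < L := by linarith
  have h0 := hC.nonneg
  have hlifts := fun k => ProjectionSystem.isFlexible_lifts hC hG hR (B := B + C) (by linarith)
    (hQ.1 k)
  have finish : ∀ A : Fin 4 → Set (S.complex K).EdgePath,
      (∀ k, ProjectionSystem.IsFlexible hG R (B + C) (αbar k) (A k)) →
      ∃ α : Fin 4 → (S.complex K).EdgePath, EdgeGraph.IsGeodesicQuadrilateral α ∧
        (∀ k, (α k).map (S.quotientMap K (familySpan R)) = αbar k) ∧ ∀ k, α k ∈ A k := by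
    intro A hA
    obtain ⟨α, hα, he⟩ := ProjectionSystem.exists_quadrilateral hC hG hR hL hB hQ.2 hA
    have hl := fun k => (hA k).isLift _ (hα k)
    exact ⟨α, ⟨fun k => EdgeGraph.EdgePath.isGeodesic_of_map ((hl k).symm ▸ hQ.1 k), he⟩, hl, hα⟩
  -- The additional property concerns pairs of bounded lifts, so it is vacuous if no such pair
  -- exists. Otherwise one pair is fixed and sides 0 and 2 are restricted to its translates.
  by_cases hex : ∃ β₀ β₂ : (S.complex K).EdgePath,
      β₀.map (S.quotientMap K (familySpan R)) = αbar 0 ∧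
      β₂.map (S.quotientMap K (familySpan R)) = αbar 2 ∧
      S.ProjectionsBoundedBy β₀ B ∧ S.ProjectionsBoundedBy β₂ B
  · obtain ⟨β₀, β₂, l₀, l₂, b₀, b₂⟩ := hex
    -- All four sides must share one bending threshold: the unrestricted sides need at least `C`,
    -- the restricted ones at least `B`, and `B + C` serves both.
    have weaken : ∀ {β : (S.complex K).EdgePath}, S.ProjectionsBoundedBy β B →
        S.ProjectionsBoundedBy β (B + C) := fun h v hs hf => (h v hs hf).trans (by linarith)
    obtain ⟨α, h1, h2, h3⟩ := finish
      ![{α | ∃ h ∈ familySpan R, α = β₀.map (hG.translate K h)}, _,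
        {α | ∃ h ∈ familySpan R, α = β₂.map (hG.translate K h)}, _] (by
        intro k
        fin_cases k
        exacts [ProjectionSystem.isFlexible_translates hG hR l₀ (weaken b₀), hlifts 1,
          ProjectionSystem.isFlexible_translates hG hR l₂ (weaken b₂), hlifts 3])
    refine ⟨α, h1, h2, fun γ₀ γ₂ m₀ m₂ c₀ c₂ => ⟨?_, ?_⟩⟩
    · obtain ⟨h, hh, e⟩ := h3 0
      obtain ⟨g, hg, e'⟩ := ProjectionSystem.exists_translate_eq hC hG hR hL hB (hQ.1 0) l₀ m₀ b₀ c₀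
      exact ⟨h * g, mul_mem hh hg, by
        rw [e, e', ProjectionSystem.translate_translate]⟩
    · obtain ⟨h, hh, e⟩ := h3 2
      obtain ⟨g, hg, e'⟩ := ProjectionSystem.exists_translate_eq hC hG hR hL hB (hQ.1 2) l₂ m₂ b₂ c₂
      exact ⟨h * g, mul_mem hh hg, by
        rw [e, e', ProjectionSystem.translate_translate]⟩
  · obtain ⟨α, h1, h2, -⟩ := finish _ hlifts
    exact ⟨α, h1, h2, fun γ₀ γ₂ m₀ m₂ c₀ c₂ => absurd ⟨γ₀, γ₂, m₀, m₂, c₀, c₂⟩ hex⟩
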